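/- Setting. All Hilbert spaces are complex, and spans denoted $\overline{\mathrm{span}}$ are closed linear spans. Let $N\ge 2$, let $K$ be a Hilbert space and let $V_0,\dots,V_{N-1}$ be bounded operators on $K$ with $\sum_i V_iV_i^*=I_K$ (a row co-isometry). Let $(H,S_i)_{i=0}^{N-1}$ be its Cuntz dilation: $H\supseteq K$ is a Hilbert space, $S_i^*S_j=\delta_{ij}I_H$, $\sum_i S_iS_i^*=I_H$, $S_i^*K\subseteq K$ and $S_i^*|_K=V_i^*$ (so that $V_i=P_KS_i|_K$), and $K$ is cyclic, i.e. no proper closed subspace of $H$ that is invariant under all $S_i,S_i^*$ contains $K$. A representation of the Cuntz relations on a nonzero Hilbert space is irreducible if no closed subspaces other than $0$ and the whole space are invariant under all $S_i$ and $S_i^*$. Let $\Omega$ be the set of all finite words over $\{0,\dots,N-1\}$, including the empty word $\emptyset$; for $\omega=\omega_1\cdots\omega_n$ put $V_\omega=V_{\omega_1}\cdots V_{\omega_n}$ and $S_\omega=S_{\omega_1}\cdots S_{\omega_n}$. Let $K_0\subseteq K$ be a closed subspace with an orthonormal basis $(e_c)_{c\in M}$, $M$ finite, and let $g_i:M\to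 M$, $\nu_i:M\to\mathbb C$ be maps such that $\{V_i\}$ acts on $K_0$ as a random walk on $(M,\{g_i\},\{\nu_i\})$: $V_i^*K_0\subseteq K_0$; $V_i^*e_c=\nu_i(c)e_{g_i(c)}$ for all $i,c$; and if $\nu_i(c_1)\ne0$, $\nu_i(c_2)\neq 0$ and $g_i(c_1)=g_i(c_2)$, then $c_1=c_2$. Put $g_\omega=g_{\omega_n}\circ\cdots\circ g_{\omega_1}$ and $\nu_\omega(c)=\nu_{\omega_1}(c)\,\nu_{\omega_2}(g_{\omega_1}(c))\cdots\nu_{\omega_n}(g_{\omega_1\cdots\omega_{n-1}}(c))$. Assume that the walk is irreducible (for all $c_1,c_2\in M$ there is $\omega\in\Omega$ with $g_\omega(c_1)=c_2$ and $\nu_\omega(c_1)\neq0$) and that $\{V_i\}$ is simple on $K_0$ (the only operators $T$ on $K_0$ with $P_{K_0}\big(\sum_iV_iTV_i^*\big)P_{K_0}=T$ are the scalar multiples of $I_{K_0}$). A cycle word for $c\in M$ is a nonempty word $\beta$ with $g_\beta(c)=c$, $\nu_\beta(c)\ne0$, and $g_{\beta'}(c)\neq c$ for every nonempty proper prefix $\beta'$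 of $\beta$. Fix $c\in M$. Let $\Omega_c^{(0)}$ be the set of words in $\Omega$ that do not end in a cycle word for $c$, and for $n\ge1$ let $\Omega_c^{(n)}$ be the set of words $\omega_0\beta_1\cdots\beta_n$ with $\omega_0\in\Omega_c^{(0)}$ and $\beta_1,\dots,\beta_n$ cycle words for $c$. Put $\mathcal E_c^{(n)}=\{S_\omega e_c:\omega\in\Omega_c^{(n)}\}$, $H_c^{(n)}=\overline{\mathrm{span}}\,\mathcal E_c^{(n)}$ and $V=\overline{\mathrm{span}}\{S_\omega e_c:\omega\in\Omega\}$. Theorem. (a) For every $n\ge0$ the family $(S_\omega e_c)_{\omega\in\Omega_c^{(n)}}$ is an orthonormal basis of $H_c^{(n)}$. (b) $H_c^{(n)}\subseteq H_c^{(n+1)}$ for all $n\geq0$. (c) $\bigcup_{n\ge0}\mathcal E_c^{(n)}=\{S_\omega e_c:\omega\in\Omega\}$. (d) $V=\overline{\bigcup_{n\ge0}H_c^{(n)}}$; $V$ contains $K_0$ and is invariant under all $S_i$ and $S_i^*$; $(K_0,P_{K_0}V_iP_{K_0})_{i=0}^{N-1}$ is a row co-isometry, its Cuntz dilation is $(V,S_i|_V)_{i=0}^{N-1}$,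 and this representation is irreducible. Moreover, the following are equivalent: (i) $V=H$; (ii) $(H,S_i)_{i=0}^{N-1}$ is irreducible; (iii) the only bounded operators $T$ on $K$ with $\sum_iV_iTV_i^*=T$ are the scalar multiples of $I_K$. Suppose in addition that $\{V_i\}$ is reversing, that is, $V_ie_{g_i(c')}=\overline{\nu_i(c')}\,e_{c'}$ for all $i$ and all $c'\in M$ with $\nu_i(c')\ne0$. Then: (e) for all $n\ge0$ and $v\in K$, $$\|P_{H_c^{(n)}}v\|^2=\sum_{\omega\in\Omega_c^{(0)}}|\langle V_\omega e_c,v\rangle|^2=\|P_{H_c^{(0)}}v\|^2=\|P_Vv\|^2;$$ and (i), (ii), (iii) are also equivalent to (iv): the family $(V_\omega e_c)_{\omega\in\Omega_c^{(0)}}$ is a Parseval frame for $K$, i.e. $\|v\|^2=\sum_{\omega\in\Omega_c^{(0)}}|\langle v,V_\omega e_c\rangle|^2$ for all $v\in K$. -/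

import Mathlib

open scoped InnerProductSpace ComplexConjugate

noncomputable section

namespace CuntzWalk

/-! ### Row co-isometries and Cuntz dilations -/

section Operators

variable {N : ℕ}
  {K : Type*} [NormedAddCommGroup K] [InnerProductSpace ℂ K] [CompleteSpace K]
  {H : Type*} [NormedAddCommGroup H] [InnerProductSpace ℂ H] [CompleteSpace H]

/-- `∑ i, V i ∘ (V i)* = I`. -/
def IsRowCoisometry (V : Fin N → K →L[ℂ] K) : Prop :=
  ∑ i, V i ∘L ContinuousLinearMap.adjoint (V i) = ContinuousLinearMap.id ℂ K

/-- The Cuntz relations `(S i)* S j = δ_{ij} I` and `∑ i, S i (S i)* = I`. -/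
structure IsCuntzRep (S : Fin N → H →L[ℂ] H) : Prop where
  isometry : ∀ i, ContinuousLinearMap.adjoint (S i) ∘L S i = ContinuousLinearMap.id ℂ H
  orthogonal : ∀ i j, i ≠ j → ContinuousLinearMap.adjoint (S i) ∘L S j = 0
  sum_eq : ∑ i, S i ∘L ContinuousLinearMap.adjoint (S i) = ContinuousLinearMap.id ℂ H

/-- The subspace `W` is invariant under all `S i` and all `(S i)*`. -/
def IsInvariantSubspace (S : Fin N → H →L[ℂ] H) (W : Submodule ℂ H) : Prop :=
  (∀ i, ∀ x ∈ W, S i x ∈ W) ∧ (∀ i, ∀ x ∈ W, ContinuousLinearMap.adjoint (S i) x ∈ W)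

/-- The representation has no closed invariant subspaces besides `0` and the whole
(nonzero) space. -/
def IsIrreducibleRep (S : Fin N → H →L[ℂ] H) : Prop :=
  Nontrivial H ∧
    ∀ W : Submodule ℂ H, IsClosed (W : Set H) → IsInvariantSubspace S W → W = ⊥ ∨ W = ⊤

/-- `(H, S)` is the Cuntz dilation of `(K, V)`, where `K` is regarded as a subspace of `H` through
the linear isometry `J`; the projection `p : H → K` is then the adjoint of `J`. -/
structure IsCuntzDilation (V : Fin N → K →L[ℂ] K) (S : Fin N → H →L[ℂ] H)
    (J : K →ₗᵢ[ℂ] H) : Prop where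
  cuntz : IsCuntzRep S
  /-- `K` is invariant under `(S i)*`, which acts on it as `(V i)*`. -/
  adjoint_apply : ∀ i k,
    ContinuousLinearMap.adjoint (S i) (J k) = J (ContinuousLinearMap.adjoint (V i) k)
  /-- `V i = p (S i)` on `K`. -/
  compression : ∀ i,
    V i = ContinuousLinearMap.adjoint J.toContinuousLinearMap ∘L S i ∘L J.toContinuousLinearMap
  /-- `K` is cyclic for the representation. -/
  cyclic : ∀ W : Submodule ℂ H, IsClosed (W : Set H) → IsInvariantSubspace S W →
    (∀ k, J k ∈ W) → W = ⊤

/-- The compression `P A P` to the closed subspace `K₀`, as an operator on `K₀`. -/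
def compress (K₀ : Submodule ℂ K) [CompleteSpace K₀] (A : K →L[ℂ] K) : K₀ →L[ℂ] K₀ :=
  K₀.orthogonalProjectionOnto ∘L A ∘L K₀.subtypeL

/-- An operator on `K₀`, extended by `0` on the orthogonal complement of `K₀`. -/
def extendZero (K₀ : Submodule ℂ K) [CompleteSpace K₀] (T : K₀ →L[ℂ] K₀) : K →L[ℂ] K :=
  K₀.subtypeL ∘L T ∘L K₀.orthogonalProjectionOnto

/-- `V` is simple on `K₀`: the only operators `T` on `K₀` with `P (∑ i, V i T (V i)*) P = T`
are the scalars. -/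
def IsSimpleOn (V : Fin N → K →L[ℂ] K) (K₀ : Submodule ℂ K) [CompleteSpace K₀] : Prop :=
  ∀ T : K₀ →L[ℂ] K₀,
    compress K₀ (∑ i, V i ∘L extendZero K₀ T ∘L ContinuousLinearMap.adjoint (V i)) = T →
      ∃ z : ℂ, T = z • ContinuousLinearMap.id ℂ K₀

/-- `V_ω = V_{ω₁} ⋯ V_{ωₙ}`; words are lists of digits. -/
def wordOp (V : Fin N → K →L[ℂ] K) : List (Fin N) → K →L[ℂ] K
  | [] => ContinuousLinearMap.id ℂ K
  | i :: ω => V i ∘L wordOp V ω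

/-- The closed linear span. -/
abbrev closedSpan (s : Set H) : Submodule ℂ H := (Submodule.span ℂ s).topologicalClosure

/-- A family `f` is a Parseval frame for `K`: `‖v‖² = ∑ |⟨v, f a⟩|²` for all `v`. -/
def IsParsevalFrame {ι : Type*} (f : ι → K) : Prop :=
  ∀ v : K, HasSum (fun a => ‖⟪v, f a⟫_ℂ‖ ^ 2) (‖v‖ ^ 2)

end Operators

/-! ### Random walks -/

section Walk

variable {N : ℕ} {M : Type*}

/-- `g_ω = g_{ωₙ} ∘ ⋯ ∘ g_{ω₁}`. -/
def walk (g : Fin N → M → M) : List (Fin N) → M → M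
  | [], c => c
  | i :: ω, c => walk g ω (g i c)

/-- `ν_ω(c) = ν_{ω₁}(c) ν_{ω₂}(g_{ω₁}(c)) ⋯ ν_{ωₙ}(g_{ω₁⋯ωₙ₋₁}(c))`. -/
def weight (g : Fin N → M → M) (ν : Fin N → M → ℂ) : List (Fin N) → M → ℂ
  | [], _ => 1
  | i :: ω, c => ν i c * weight g ν ω (g i c)

/-- Every vertex can be reached from every vertex with positive probability. -/
def IsIrreducibleWalk (g : Fin N → M → M) (ν : Fin N → M → ℂ) : Prop :=
  ∀ c₁ c₂ : M, ∃ ω : List (Fin N), walk g ω c₁ = c₂ ∧ weight g ν ω c₁ ≠ 0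

/-- `β` is a cycle word for `c`: a nonempty word leading from `c` back to `c` with positive
probability, for the first time at its end. -/
def IsCycleWord (g : Fin N → M → M) (ν : Fin N → M → ℂ) (c : M) (β : List (Fin N)) : Prop :=
  β ≠ [] ∧ walk g β c = c ∧ (∀ k, 0 < k → k < β.length → walk g (β.take k) c ≠ c) ∧
    weight g ν β c ≠ 0

/-- The words that do not end in a cycle word for `c`. -/
def acyclicWords (g : Fin N → M → M) (ν : Fin N → M → ℂ) (c : M) : Set (List (Fin N)) :=
  {ω | ¬ ∃ ω₀ β, IsCycleWord g ν c β ∧ ω = ω₀ ++ β}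

/-- The words `ω₀ β₁ ⋯ βₙ` with `ω₀` not ending in a cycle word for `c` and `β₁, …, βₙ` cycle
words for `c`; for `n = 0` these are the words not ending in a cycle word for `c`. -/
def cycleWords (g : Fin N → M → M) (ν : Fin N → M → ℂ) (c : M) (n : ℕ) : Set (List (Fin N)) :=
  {ω | ∃ ω₀ ∈ acyclicWords g ν c, ∃ βs : List (List (Fin N)),
    βs.length = n ∧ (∀ β ∈ βs, IsCycleWord g ν c β) ∧ ω = ω₀ ++ βs.flatten}

variable {K : Type*} [NormedAddCommGroup K] [InnerProductSpace ℂ K] [CompleteSpace K]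

/-- `V` acts on `K₀` as a random walk on the graph `(M, g, ν)` with orthonormal basis `e`. -/
structure ActsAsRandomWalk [Fintype M] (V : Fin N → K →L[ℂ] K) (K₀ : Submodule ℂ K)
    (e : OrthonormalBasis M ℂ K₀) (g : Fin N → M → M) (ν : Fin N → M → ℂ) : Prop where
  invariant : ∀ i, ∀ x ∈ K₀, ContinuousLinearMap.adjoint (V i) x ∈ K₀
  adjoint_apply : ∀ i c, ContinuousLinearMap.adjoint (V i) (e c : K) = ν i c • (e (g i c) : K)
  injective : ∀ i c₁ c₂, ν i c₁ ≠ 0 → ν i c₂ ≠ 0 → g i c₁ = g i c₂ → c₁ = c₂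

/-- `V i e_{g i c} = conj (ν i c) e_c` whenever `ν i c ≠ 0`. -/
def IsReversing [Fintype M] (V : Fin N → K →L[ℂ] K) {K₀ : Submodule ℂ K}
    (e : OrthonormalBasis M ℂ K₀) (g : Fin N → M → M) (ν : Fin N → M → ℂ) : Prop :=
  ∀ i c, ν i c ≠ 0 → V i (e (g i c) : K) = conj (ν i c) • (e c : K)

/-- `𝓔_c^{(n)} = {S_ω x : ω ∈ Ω_c^{(n)}}`. -/
def cycleVectors (S : Fin N → K →L[ℂ] K) (g : Fin N → M → M) (ν : Fin N → M → ℂ) (c : M)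
    (x : K) (n : ℕ) : Set K :=
  (fun ω => wordOp S ω x) '' cycleWords g ν c n

/-- The closed span `H_c^{(n)}` of `𝓔_c^{(n)}`. -/
abbrev cycleSpace (S : Fin N → K →L[ℂ] K) (g : Fin N → M → M) (ν : Fin N → M → ℂ) (c : M)
    (x : K) (n : ℕ) : Submodule ℂ K :=
  closedSpan (cycleVectors S g ν c x n)

/-- The closed span `V` of all `S_ω x`. -/
abbrev orbitSpace (S : Fin N → K →L[ℂ] K) (x : K) : Submodule ℂ K :=
  closedSpan (Set.range fun ω => wordOp S ω x)

end Walk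

end CuntzWalk

end

open CuntzWalk

/-! The geometry of the vectors `S_ω e_c` is governed by loops at `c`, that is, words leading from
`c` back to `c` with nonzero weight. Two vectors `S_u x`, `S_w y` are orthogonal unless one word is
a prefix of the other, and the adjoints `(S i)*` move `e_c` along the walk. Hence `S_ω e_c` and
`S_ω' e_c` can fail to be orthogonal only if one word is the other followed by a loop
(`exists_loop_of_inner_ne_zero`). Every loop is a product of cycle words in exactly one way, since
these form a prefix code. Because steps of nonzero weight can be reversed uniquely, every word is an
acyclic word followed by a loop in exactly one way. So no two distinct words with `n` cycle factors
differ by a loop, which gives (a).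

The inclusions (b), the containment of `K₀` in the orbit space and the invariance of that space all
come from recurrence of a finite irreducible walk: `e_c'` lies in the closed span of the `S_β e_c`
over first-passage words `β` from `c'` to `c` (`mem_closedSpan_hittingWords`). The squared distance
to this span is subharmonic, so a maximum principle forces it to vanish.

Irreducibility is read off fixed points of `T ↦ ∑ V i T (V i)*`. The projection onto an invariant
subspace lies in the commutant and compresses to a fixed point; commutant elements are determined by
their compressions (`eq_zero_of_comm`), so scalar fixed points imply irreducibility. This proves
(iii) → (ii), and applied to the compression to `K₀`, which is simple, it gives the irreducibility
in (d). For (i) → (iii), a fixed point is determined by its compression to `K₀` as soon as the orbit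
of `e_c` fills `H` (`eq_zero_of_conjSum_eq`).

In the reversing case `V_γ e_c` is a multiple of `e_c` for each loop `γ`, so the coefficients of `v
∈ K` along the orbit are determined by those at acyclic words. Its projection onto the orbit space
therefore already lies in the space with `n = 0`, and Parseval's identity there yields (e) and (iv).
-/

namespace CuntzWalk

/-! ### Loops of the walk -/

section Words

variable {N : ℕ} {M : Type*} {g : Fin N → M → M} {ν : Fin N → M → ℂ} {c : M}

theorem walk_append (u w : List (Fin N)) (c : M) :
    walk g (u ++ w) c = walk g w (walk g u c) := by
  induction u generalizing c with
  | nil => rfl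
  | cons i u ih => exact ih _

theorem weight_append (u w : List (Fin N)) (c : M) :
    weight g ν (u ++ w) c = weight g ν u c * weight g ν w (walk g u c) := by
  induction u generalizing c with
  | nil => simp [weight, walk]
  | cons i u ih => simp only [List.cons_append, weight, walk, ih, mul_assoc]

/-- Injectivity of single steps of nonzero weight propagates: such paths can be traced backwards. -/
theorem eq_of_walk_eq (hinj : ∀ i c₁ c₂, ν i c₁ ≠ 0 → ν i c₂ ≠ 0 → g i c₁ = g i c₂ → c₁ = c₂)
    {γ : List (Fin N)} {c₁ c₂ : M} (h₁ : weight g ν γ c₁ ≠ 0) (h₂ : weight g ν γ c₂ ≠ 0)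
    (h : walk g γ c₁ = walk g γ c₂) : c₁ = c₂ := by
  induction γ generalizing c₁ c₂ with
  | nil => exact h
  | cons i γ ih =>
    simp only [weight, mul_ne_zero_iff] at h₁ h₂
    exact hinj i _ _ h₁.1 h₂.1 (ih h₁.2 h₂.2 h)

/-- A word leading from `c` back to `c` with positive probability. -/
def IsLoop (g : Fin N → M → M) (ν : Fin N → M → ℂ) (c : M) (γ : List (Fin N)) : Prop :=
  walk g γ c = c ∧ weight g ν γ c ≠ 0

theorem IsLoop.nil : IsLoop g ν c [] := ⟨rfl, by simp [weight]⟩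

theorem IsLoop.append {u w : List (Fin N)} (hu : IsLoop g ν c u) (hw : IsLoop g ν c w) :
    IsLoop g ν c (u ++ w) := by
  refine ⟨by rw [walk_append, hu.1, hw.1], ?_⟩
  rw [weight_append, hu.1]
  exact mul_ne_zero hu.2 hw.2

theorem IsLoop.of_append_right {u w : List (Fin N)} (hu : IsLoop g ν c u)
    (h : IsLoop g ν c (u ++ w)) : IsLoop g ν c w := by
  have h1 := h.1
  have h2 := h.2
  rw [walk_append, hu.1] at h1
  rw [weight_append, hu.1] at h2
  exact ⟨h1, right_ne_zero_of_mul h2⟩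

/-- Cancellation of a loop on the right, unlike on the left, needs backward uniqueness: reading `w`
from the end of `u` and from `c` ends at the same vertex. -/
theorem IsLoop.of_append_left
    (hinj : ∀ i c₁ c₂, ν i c₁ ≠ 0 → ν i c₂ ≠ 0 → g i c₁ = g i c₂ → c₁ = c₂)
    {u w : List (Fin N)} (hw : IsLoop g ν c w)
    (h : IsLoop g ν c (u ++ w)) : IsLoop g ν c u := by
  have h1 := h.1
  have h2 := h.2
  rw [walk_append] at h1
  rw [weight_append] at h2
  exact ⟨eq_of_walk_eq hinj (right_ne_zero_of_mul h2) hw.2 (h1.trans hw.1.symm),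
    left_ne_zero_of_mul h2⟩

theorem IsCycleWord.isLoop {β : List (Fin N)} (h : IsCycleWord g ν c β) : IsLoop g ν c β :=
  ⟨h.2.1, h.2.2.2⟩

theorem IsLoop.flatten {βs : List (List (Fin N))} (h : ∀ β ∈ βs, IsCycleWord g ν c β) :
    IsLoop g ν c βs.flatten := by
  induction βs with
  | nil => exact IsLoop.nil
  | cons β βs ih =>
    rw [List.forall_mem_cons] at h
    exact h.1.isLoop.append (ih h.2)

/-- The loop is cut at its first return to `c`. -/
theorem IsLoop.exists_cycleWord_append {γ : List (Fin N)} (h : IsLoop g ν c γ) (hne : γ ≠ []) :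
    ∃ β γ', IsCycleWord g ν c β ∧ IsLoop g ν c γ' ∧ γ = β ++ γ' := by
  classical
  have hex : ∃ k, 0 < k ∧ k ≤ γ.length ∧ walk g (γ.take k) c = c :=
    ⟨γ.length, List.length_pos_iff.2 hne, le_rfl, by simpa using h.1⟩
  obtain ⟨hk, hkl, hkw⟩ := Nat.find_spec hex
  have hmin := fun j => Nat.find_min (m := j) hex
  generalize Nat.find hex = k at *
  have hl : IsLoop g ν c (γ.take k) := by
    refine ⟨hkw, ?_⟩
    have h2 := h.2
    rw [← List.take_append_drop k γ, weight_append] at h2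
    exact left_ne_zero_of_mul h2
  have hlen : (γ.take k).length = k := by simpa using hkl
  refine ⟨γ.take k, γ.drop k, ⟨?_, hkw, ?_, hl.2⟩, ?_, (List.take_append_drop k γ).symm⟩
  · intro h0
    rw [h0] at hlen
    simp at hlen
    omega
  · intro j hj hjk hw
    rw [hlen] at hjk
    rw [List.take_take, min_eq_left hjk.le] at hw
    exact hmin j hjk ⟨hj, by omega, hw⟩
  · refine hl.of_append_right ?_
    rwa [List.take_append_drop]

theorem IsLoop.exists_flatten {γ : List (Fin N)} (h : IsLoop g ν c γ) :
    ∃ βs : List (List (Fin N)), (∀ β ∈ βs, IsCycleWord g ν c β) ∧ γ = βs.flatten := by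
  by_cases hne : γ = []
  · exact ⟨[], by simp, by simpa using hne⟩
  · obtain ⟨β, γ', hβ, hγ', rfl⟩ := h.exists_cycleWord_append hne
    have : γ'.length < (β ++ γ').length := by
      have := List.length_pos_iff.2 hβ.1
      rw [List.length_append]
      omega
    obtain ⟨βs, hβs, rfl⟩ := hγ'.exists_flatten
    exact ⟨β :: βs, List.forall_mem_cons.2 ⟨hβ, hβs⟩, by simp⟩
termination_by γ.length

theorem IsCycleWord.eq_of_prefix {β β' : List (Fin N)} (h : IsCycleWord g ν c β)
    (h' : IsCycleWord g ν c β') (hp : β <+: β') : β = β' := by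
  by_contra hne
  have hlt : β.length < β'.length :=
    lt_of_le_of_ne hp.length_le fun hl => hne (hp.eq_of_length hl)
  refine h'.2.2.1 β.length (List.length_pos_iff.2 h.1) hlt ?_
  rw [← List.prefix_iff_eq_take.1 hp]
  exact h.2.1

/-- The cycle words for `c` form a prefix code. -/
theorem eq_of_flatten_eq {βs βs' : List (List (Fin N))} (h : ∀ β ∈ βs, IsCycleWord g ν c β)
    (h' : ∀ β ∈ βs', IsCycleWord g ν c β) (heq : βs.flatten = βs'.flatten) : βs = βs' := by
  induction βs generalizing βs' with
  | nil =>
    cases βs' with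
    | nil => rfl
    | cons β' βs' =>
      rw [List.forall_mem_cons] at h'
      simp only [List.flatten_nil, List.flatten_cons, List.nil_eq, List.append_eq_nil_iff] at heq
      exact absurd heq.1 h'.1.1
  | cons β βs ih =>
    rw [List.forall_mem_cons] at h
    cases βs' with
    | nil =>
      simp only [List.flatten_nil, List.flatten_cons, List.append_eq_nil_iff] at heq
      exact absurd heq.1 h.1.1
    | cons β' βs' =>
      rw [List.forall_mem_cons] at h'
      simp only [List.flatten_cons] at heq
      -- Two prefixes of one word are comparable, and a cycle word properly extending another would
      -- return to `c` before its end.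
      have hβ : β = β' := by
        rcases List.prefix_or_prefix_of_prefix (List.prefix_append β βs.flatten)
          (heq ▸ List.prefix_append β' βs'.flatten) with hp | hp
        · exact h.1.eq_of_prefix h'.1 hp
        · exact (h'.1.eq_of_prefix h.1 hp).symm
      subst hβ
      rw [ih h.2 h'.2 (List.append_cancel_left heq)]

theorem IsLoop.eq_nil_of_acyclicWords {ω γ : List (Fin N)} (hγ : IsLoop g ν c γ)
    (h : ω ++ γ ∈ acyclicWords g ν c) : γ = [] := by
  obtain ⟨βs, hβs, rfl⟩ := hγ.exists_flatten
  rcases List.eq_nil_or_concat' βs with rfl | ⟨βs', β, rfl⟩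
  · rfl
  · exact absurd ⟨ω ++ βs'.flatten, β, hβs β (by simp), by simp⟩ h

theorem exists_acyclicWords_append_loop (ω : List (Fin N)) :
    ∃ ω₀ γ, ω₀ ∈ acyclicWords g ν c ∧ IsLoop g ν c γ ∧ ω = ω₀ ++ γ := by
  by_cases h : ω ∈ acyclicWords g ν c
  · exact ⟨ω, [], h, IsLoop.nil, by simp⟩
  · simp only [acyclicWords, Set.mem_ofPred_eq, not_not] at h
    obtain ⟨ω₁, β, hβ, rfl⟩ := h
    have : ω₁.length < (ω₁ ++ β).length := by
      have := List.length_pos_iff.2 hβ.1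
      rw [List.length_append]
      omega
    obtain ⟨ω₀, γ, h₀, hγ, rfl⟩ := exists_acyclicWords_append_loop ω₁
    exact ⟨ω₀, γ ++ β, h₀, hγ.append hβ.isLoop, by simp⟩
termination_by ω.length

/-- The longer of the two acyclic words exceeds the shorter by some `α`. Cancelling loops shows that
`α` is itself a loop, and an acyclic word ends in no nonempty loop. -/
theorem eq_of_acyclicWords_append_loop
    (hinj : ∀ i c₁ c₂, ν i c₁ ≠ 0 → ν i c₂ ≠ 0 → g i c₁ = g i c₂ → c₁ = c₂)
    {ω ω' γ γ' : List (Fin N)} (h : ω ∈ acyclicWords g ν c) (h' : ω' ∈ acyclicWords g ν c)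
    (hγ : IsLoop g ν c γ) (hγ' : IsLoop g ν c γ') (heq : ω ++ γ = ω' ++ γ') :
    ω = ω' ∧ γ = γ' := by
  rcases List.append_eq_append_iff.1 heq with ⟨α, rfl, rfl⟩ | ⟨α, rfl, rfl⟩
  · obtain rfl := (hγ'.of_append_left hinj hγ).eq_nil_of_acyclicWords h'
    simp
  · obtain rfl := (hγ.of_append_left hinj hγ').eq_nil_of_acyclicWords h
    simp

theorem cycleWords_zero : cycleWords g ν c 0 = acyclicWords g ν c := by
  ext ω
  constructor
  · rintro ⟨ω₀, h₀, βs, hlen, -, rfl⟩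
    rw [List.length_eq_zero_iff] at hlen
    simpa [hlen] using h₀
  · exact fun h => ⟨ω, h, [], rfl, by simp, by simp⟩

theorem append_mem_cycleWords_succ {ω β : List (Fin N)} {n : ℕ} (h : ω ∈ cycleWords g ν c n)
    (hβ : IsCycleWord g ν c β) : ω ++ β ∈ cycleWords g ν c (n + 1) := by
  obtain ⟨ω₀, h₀, βs, hlen, hβs, rfl⟩ := h
  refine ⟨ω₀, h₀, βs ++ [β], by simp [hlen], ?_, by simp⟩
  intro β' hβ'
  rcases List.mem_append.1 hβ' with hm | hm
  · exact hβs _ hm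
  · rw [List.mem_singleton.1 hm]
    exact hβ

theorem exists_mem_cycleWords (ω : List (Fin N)) : ∃ n, ω ∈ cycleWords g ν c n := by
  obtain ⟨ω₀, γ, h₀, hγ, rfl⟩ := exists_acyclicWords_append_loop (g := g) (ν := ν) (c := c) ω
  obtain ⟨βs, hβs, rfl⟩ := hγ.exists_flatten
  exact ⟨βs.length, ω₀, h₀, βs, rfl, hβs, rfl⟩

/-- No word of `cycleWords g ν c n` is a proper extension of another one by a loop. -/
theorem IsLoop.eq_nil_of_cycleWords
    (hinj : ∀ i c₁ c₂, ν i c₁ ≠ 0 → ν i c₂ ≠ 0 → g i c₁ = g i c₂ → c₁ = c₂)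
    {ω γ : List (Fin N)} {n : ℕ} (hγ : IsLoop g ν c γ)
    (h : ω ∈ cycleWords g ν c n) (h' : ω ++ γ ∈ cycleWords g ν c n) : γ = [] := by
  obtain ⟨ω₀, h₀, βs, hlen, hβs, rfl⟩ := h
  obtain ⟨ω₁, h₁, βs', hlen', hβs', heq⟩ := h'
  obtain ⟨γs, hγs, rfl⟩ := hγ.exists_flatten
  have hall : ∀ β ∈ βs ++ γs, IsCycleWord g ν c β := fun β hβ =>
    (List.mem_append.1 hβ).elim (hβs β) (hγs β)
  rw [List.append_assoc, ← List.flatten_append] at heq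
  -- Both the acyclic prefix and the list of cycle factors are unique, so counting factors leaves
  -- none for `γ`.
  have h2 := eq_of_flatten_eq hall hβs'
    (eq_of_acyclicWords_append_loop hinj h₀ h₁ (IsLoop.flatten hall) (IsLoop.flatten hβs') heq).2
  have h3 := congrArg List.length h2
  rw [List.length_append, hlen, hlen'] at h3
  have : γs = [] := List.length_eq_zero_iff.1 (by omega)
  simp [this]

/-- The nonempty words leading with positive probability from `c'` to `c`, and to `c` for the first
time at their end. -/
def hittingWords (g : Fin N → M → M) (ν : Fin N → M → ℂ) (c c' : M) : Set (List (Fin N)) :=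
  {ω | ω ≠ [] ∧ walk g ω c' = c ∧ (∀ k, 0 < k → k < ω.length → walk g (ω.take k) c' ≠ c) ∧
    weight g ν ω c' ≠ 0}

theorem singleton_mem_hittingWords {c' : M} {i : Fin N} (h : g i c' = c) (hν : ν i c' ≠ 0) :
    [i] ∈ hittingWords g ν c c' := by
  refine ⟨by simp, h, fun k hk hk' => ?_, by simpa [weight] using hν⟩
  simp at hk'
  omega

theorem cons_mem_hittingWords {c' : M} {i : Fin N} {ω : List (Fin N)} (h : g i c' ≠ c)
    (hν : ν i c' ≠ 0) (hω : ω ∈ hittingWords g ν c (g i c')) :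
    i :: ω ∈ hittingWords g ν c c' := by
  refine ⟨by simp, hω.2.1, fun k hk hk' => ?_, mul_ne_zero hν hω.2.2.2⟩
  obtain ⟨k, rfl⟩ : ∃ j, k = j + 1 := ⟨k - 1, by omega⟩
  rw [List.take_succ_cons]
  rcases Nat.eq_zero_or_pos k with rfl | hk0
  · exact h
  · exact hω.2.2.1 k hk0 (by simpa using hk')

end Words

/-! ### Cuntz representations -/

section Cuntz

variable {N : ℕ} {H : Type*} [NormedAddCommGroup H] [InnerProductSpace ℂ H]

theorem wordOp_append (S : Fin N → H →L[ℂ] H) (u w : List (Fin N)) (x : H) :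
    wordOp S (u ++ w) x = wordOp S u (wordOp S w x) := by
  induction u with
  | nil => rfl
  | cons i u ih => exact congrArg (S i) ih

theorem subset_closedSpan (s : Set H) : s ⊆ closedSpan s :=
  Submodule.subset_span.trans (Submodule.le_topologicalClosure _)

theorem closedSpan_le {s : Set H} {W : Submodule ℂ H} (hW : IsClosed (W : Set H)) (h : s ⊆ W) :
    closedSpan s ≤ W :=
  Submodule.topologicalClosure_minimal _ (Submodule.span_le.2 h) hW

theorem isClosed_comap {E F : Type*} [NormedAddCommGroup E] [InnerProductSpace ℂ E]
    [NormedAddCommGroup F] [InnerProductSpace ℂ F] {W : Submodule ℂ F}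
    (hW : IsClosed (W : Set F)) (A : E →L[ℂ] F) :
    IsClosed (W.comap (A : E →ₗ[ℂ] F) : Set E) :=
  hW.preimage A.continuous

theorem closedSpan_map_le {s : Set H} {W : Submodule ℂ H} (hW : IsClosed (W : Set H))
    (A : H →L[ℂ] H) (h : ∀ x ∈ s, A x ∈ W) {x : H} (hx : x ∈ closedSpan s) : A x ∈ W :=
  closedSpan_le (isClosed_comap hW A) h hx

variable [CompleteSpace H] {S : Fin N → H →L[ℂ] H} (hS : IsCuntzRep S)
include hS

theorem IsCuntzRep.adjoint_apply_self (i : Fin N) (x : H) :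
    ContinuousLinearMap.adjoint (S i) (S i x) = x :=
  DFunLike.congr_fun (hS.isometry i) x

theorem IsCuntzRep.adjoint_apply_of_ne {i j : Fin N} (h : i ≠ j) (x : H) :
    ContinuousLinearMap.adjoint (S i) (S j x) = 0 :=
  DFunLike.congr_fun (hS.orthogonal i j h) x

theorem IsCuntzRep.sum_apply (x : H) :
    ∑ i, S i (ContinuousLinearMap.adjoint (S i) x) = x := by
  simpa using DFunLike.congr_fun hS.sum_eq x

theorem IsCuntzRep.inner_apply_self (i : Fin N) (x y : H) : ⟪S i x, S i y⟫_ℂ = ⟪x, y⟫_ℂ := by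
  rw [← ContinuousLinearMap.adjoint_inner_left, hS.adjoint_apply_self]

theorem IsCuntzRep.inner_apply_of_ne {i j : Fin N} (h : i ≠ j) (x y : H) :
    ⟪S i x, S j y⟫_ℂ = 0 := by
  rw [← ContinuousLinearMap.adjoint_inner_right, hS.adjoint_apply_of_ne h, inner_zero_right]

theorem IsCuntzRep.inner_sum_apply (z y : Fin N → H) :
    ⟪∑ i, S i (z i), ∑ i, S i (y i)⟫_ℂ = ∑ i, ⟪z i, y i⟫_ℂ := by
  rw [sum_inner]
  refine Finset.sum_congr rfl fun i _ => ?_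
  rw [inner_sum, Finset.sum_eq_single i, hS.inner_apply_self]
  · exact fun j _ hj => hS.inner_apply_of_ne hj.symm _ _
  · simp

theorem IsCuntzRep.norm_sq_sum_apply (z : Fin N → H) :
    ‖∑ i, S i (z i)‖ ^ 2 = ∑ i, ‖z i‖ ^ 2 := by
  have h := hS.inner_sum_apply z z
  simp only [inner_self_eq_norm_sq_to_K] at h
  exact_mod_cast h

theorem IsCuntzRep.sum_norm_sq_adjoint (x : H) :
    ∑ i, ‖ContinuousLinearMap.adjoint (S i) x‖ ^ 2 = ‖x‖ ^ 2 := by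
  rw [← hS.norm_sq_sum_apply, hS.sum_apply]

theorem IsCuntzRep.inner_wordOp_self (u : List (Fin N)) (x y : H) :
    ⟪wordOp S u x, wordOp S u y⟫_ℂ = ⟪x, y⟫_ℂ := by
  induction u with
  | nil => rfl
  | cons i u ih => exact (hS.inner_apply_self i _ _).trans ih

theorem IsCuntzRep.prefix_of_inner_wordOp_ne_zero {u w : List (Fin N)} {x y : H}
    (h : ⟪wordOp S u x, wordOp S w y⟫_ℂ ≠ 0) : u <+: w ∨ w <+: u := by
  induction u generalizing w with
  | nil => exact Or.inl (List.nil_prefix)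
  | cons i u ih =>
    cases w with
    | nil => exact Or.inr (List.nil_prefix)
    | cons j w =>
      by_cases hij : i = j
      · subst hij
        rw [List.prefix_cons_inj, List.prefix_cons_inj]
        exact ih (by rwa [← hS.inner_apply_self i])
      · exact absurd (hS.inner_apply_of_ne hij _ _) h

end Cuntz

/-! ### Families of vectors on which a Cuntz representation acts as a random walk -/

section MaximumPrinciple

variable {N : ℕ} {M : Type*} {g : Fin N → M → M} {ν : Fin N → M → ℂ}

/-- The maximum principle for subharmonic functions on a finite irreducible random walk. -/
theorem IsIrreducibleWalk.le_of_subharmonic [Finite M] (hirr : IsIrreducibleWalk g ν)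
    (hsum : ∀ c, ∑ i, ‖ν i c‖ ^ 2 = 1) {a : M → ℝ}
    (ha : ∀ c, a c ≤ ∑ i, ‖ν i c‖ ^ 2 * a (g i c)) (c c' : M) : a c' ≤ a c := by
  have : Nonempty M := ⟨c⟩
  obtain ⟨m, hm⟩ := Finite.exists_max a
  -- At a maximum point the weighted average of the nonnegative gaps `a m - a (g j d)` is at most
  -- zero, so each gap with nonzero weight vanishes.
  have step : ∀ (i : Fin N) (d : M), a d = a m → ν i d ≠ 0 → a (g i d) = a m := by
    intro i d hd hν
    have hnonneg : ∀ j ∈ Finset.univ, 0 ≤ ‖ν j d‖ ^ 2 * (a m - a (g j d)) := fun j _ =>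
      mul_nonneg (sq_nonneg _) (sub_nonneg.2 (hm _))
    have hle : ∑ j, ‖ν j d‖ ^ 2 * (a m - a (g j d)) ≤ 0 := by
      simp only [mul_sub, Finset.sum_sub_distrib]
      rw [← Finset.sum_mul, hsum, one_mul]
      linarith [ha d]
    have h0 := (Finset.sum_eq_zero_iff_of_nonneg hnonneg).1
      (le_antisymm hle (Finset.sum_nonneg hnonneg)) i (Finset.mem_univ i)
    have hne : ‖ν i d‖ ^ 2 ≠ 0 := pow_ne_zero 2 (norm_ne_zero_iff.2 hν)
    linarith [(mul_eq_zero.1 h0).resolve_left hne]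
  have path : ∀ (ω : List (Fin N)) (d : M), a d = a m → weight g ν ω d ≠ 0 →
      a (walk g ω d) = a m := by
    intro ω
    induction ω with
    | nil => exact fun d hd _ => hd
    | cons i ω ih =>
      intro d hd hw
      exact ih _ (step i d hd (left_ne_zero_of_mul hw)) (right_ne_zero_of_mul hw)
  obtain ⟨ω, rfl, hw⟩ := hirr m c
  rw [path ω m rfl hw]
  exact hm c'

end MaximumPrinciple

theorem norm_sub_starProjection_le {H : Type*} [NormedAddCommGroup H] [InnerProductSpace ℂ H]
    {U : Submodule ℂ H} [U.HasOrthogonalProjection] (x : H) {y : H} (hy : y ∈ U) :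
    ‖x - U.starProjection x‖ ≤ ‖x - y‖ := by
  rw [Submodule.starProjection_minimal]
  exact ciInf_le ⟨0, by rintro _ ⟨z, rfl⟩; exact norm_nonneg _⟩ (⟨y, hy⟩ : U)

section WalkFamily

variable {N : ℕ} {M : Type*} {H : Type*} [NormedAddCommGroup H] [InnerProductSpace ℂ H]

theorem iUnion_cycleVectors (S : Fin N → H →L[ℂ] H) (g : Fin N → M → M)
    (ν : Fin N → M → ℂ) (c : M) (x : H) :
    ⋃ n, cycleVectors S g ν c x n = Set.range fun ω => wordOp S ω x := by
  ext y
  simp only [cycleVectors, Set.mem_iUnion, Set.mem_image, Set.mem_range]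
  constructor
  · rintro ⟨n, ω, -, rfl⟩
    exact ⟨ω, rfl⟩
  · rintro ⟨ω, rfl⟩
    obtain ⟨n, hn⟩ := exists_mem_cycleWords (g := g) (ν := ν) (c := c) ω
    exact ⟨n, ω, hn, rfl⟩

theorem cycleSpace_le_orbitSpace (S : Fin N → H →L[ℂ] H) (g : Fin N → M → M)
    (ν : Fin N → M → ℂ) (c : M) (x : H) (n : ℕ) : cycleSpace S g ν c x n ≤ orbitSpace S x := by
  refine closedSpan_le (Submodule.isClosed_topologicalClosure _) ?_
  rintro _ ⟨ω, -, rfl⟩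
  exact subset_closedSpan _ ⟨ω, rfl⟩

variable [CompleteSpace H]

/-- An orthonormal family on which the adjoints of a Cuntz representation act as a random walk. -/
structure IsWalkFamily (S : Fin N → H →L[ℂ] H) (f : M → H) (g : Fin N → M → M)
    (ν : Fin N → M → ℂ) : Prop where
  cuntz : IsCuntzRep S
  orthonormal : Orthonormal ℂ f
  adjoint_apply : ∀ i c, ContinuousLinearMap.adjoint (S i) (f c) = ν i c • f (g i c)
  injective : ∀ i c₁ c₂, ν i c₁ ≠ 0 → ν i c₂ ≠ 0 → g i c₁ = g i c₂ → c₁ = c₂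

namespace IsWalkFamily

variable {S : Fin N → H →L[ℂ] H} {f : M → H} {g : Fin N → M → M} {ν : Fin N → M → ℂ}

theorem sum_norm_sq (h : IsWalkFamily S f g ν) (c : M) : ∑ i, ‖ν i c‖ ^ 2 = 1 := by
  have h1 := h.cuntz.sum_norm_sq_adjoint (f c)
  simpa [h.adjoint_apply, norm_smul, h.orthonormal.1] using h1

theorem sum_smul_apply (h : IsWalkFamily S f g ν) (c : M) :
    ∑ i, ν i c • S i (f (g i c)) = f c := by
  simpa [h.adjoint_apply] using h.cuntz.sum_apply (f c)

/-- Moving the letters of `γ` to the left as adjoints makes `f c` follow the walk and collect its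
weight. -/
theorem inner_wordOp (h : IsWalkFamily S f g ν) (γ : List (Fin N)) (c : M) (y : H) :
    ⟪f c, wordOp S γ y⟫_ℂ = conj (weight g ν γ c) * ⟪f (walk g γ c), y⟫_ℂ := by
  induction γ generalizing c with
  | nil => simp [wordOp, weight, walk]
  | cons i γ ih =>
    change ⟪f c, S i (wordOp S γ y)⟫_ℂ =
      conj (ν i c * weight g ν γ (g i c)) * ⟪f (walk g γ (g i c)), y⟫_ℂ
    rw [← ContinuousLinearMap.adjoint_inner_left, h.adjoint_apply, inner_smul_left, ih, map_mul,
      mul_assoc]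

theorem inner_wordOp_append (h : IsWalkFamily S f g ν) (ω γ : List (Fin N)) (c : M) :
    ⟪wordOp S ω (f c), wordOp S (ω ++ γ) (f c)⟫_ℂ =
      conj (weight g ν γ c) * ⟪f (walk g γ c), f c⟫_ℂ := by
  rw [wordOp_append, h.cuntz.inner_wordOp_self, h.inner_wordOp]

theorem inner_wordOp_append_loop (h : IsWalkFamily S f g ν) (ω : List (Fin N)) {γ : List (Fin N)}
    {c : M} (hγ : IsLoop g ν c γ) :
    ⟪wordOp S ω (f c), wordOp S (ω ++ γ) (f c)⟫_ℂ = conj (weight g ν γ c) := by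
  rw [h.inner_wordOp_append, hγ.1, inner_self_eq_norm_sq_to_K, h.orthonormal.1]
  simp

theorem isLoop_of_inner_ne_zero (h : IsWalkFamily S f g ν) {ω γ : List (Fin N)} {c : M}
    (hne : ⟪wordOp S ω (f c), wordOp S (ω ++ γ) (f c)⟫_ℂ ≠ 0) : IsLoop g ν c γ := by
  rw [h.inner_wordOp_append] at hne
  refine ⟨?_, fun h0 => left_ne_zero_of_mul hne (by rw [h0, map_zero])⟩
  by_contra hc
  exact right_ne_zero_of_mul hne (h.orthonormal.2 hc)

theorem exists_loop_of_inner_ne_zero (h : IsWalkFamily S f g ν) {ω ω' : List (Fin N)} {c : M}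
    (hne : ⟪wordOp S ω (f c), wordOp S ω' (f c)⟫_ℂ ≠ 0) :
    (∃ γ, IsLoop g ν c γ ∧ ω' = ω ++ γ) ∨ ∃ γ, IsLoop g ν c γ ∧ ω = ω' ++ γ := by
  rcases h.cuntz.prefix_of_inner_wordOp_ne_zero hne with ⟨γ, rfl⟩ | ⟨γ, rfl⟩
  · exact Or.inl ⟨γ, h.isLoop_of_inner_ne_zero hne, rfl⟩
  · refine Or.inr ⟨γ, h.isLoop_of_inner_ne_zero (ω := ω') ?_, rfl⟩
    exact fun h0 => hne (inner_eq_zero_symm.1 h0)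

theorem orthonormal_cycleWords (h : IsWalkFamily S f g ν) (c : M) (n : ℕ) :
    Orthonormal ℂ fun ω : cycleWords g ν c n => wordOp S (ω : List (Fin N)) (f c) := by
  constructor
  · intro ω
    have h1 : ‖wordOp S (ω : List (Fin N)) (f c)‖ ^ 2 = ‖f c‖ ^ 2 := by
      have h2 := h.cuntz.inner_wordOp_self (ω : List (Fin N)) (f c) (f c)
      simp only [inner_self_eq_norm_sq_to_K] at h2
      exact_mod_cast h2
    rw [h.orthonormal.1, one_pow] at h1
    exact (pow_eq_one_iff_of_nonneg (norm_nonneg _) two_ne_zero).1 h1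
  · rintro ⟨ω, hω⟩ ⟨ω', hω'⟩ hne
    by_contra hi
    rcases h.exists_loop_of_inner_ne_zero hi with ⟨γ, hγ, rfl⟩ | ⟨γ, hγ, rfl⟩
    · obtain rfl := hγ.eq_nil_of_cycleWords h.injective hω hω'
      simp at hne
    · obtain rfl := hγ.eq_nil_of_cycleWords h.injective hω' hω
      simp at hne

theorem exists_hilbertBasis (h : IsWalkFamily S f g ν) (c : M) (n : ℕ) :
    ∃ b : HilbertBasis (cycleWords g ν c n) ℂ (cycleSpace S g ν c (f c) n),
      ∀ ω, (b ω : H) = wordOp S (ω : List (Fin N)) (f c) := by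
  set W := cycleSpace S g ν c (f c) n with hW
  have hmem : ∀ ω : cycleWords g ν c n, wordOp S (ω : List (Fin N)) (f c) ∈ W := fun ω =>
    subset_closedSpan _ ⟨ω, ω.2, rfl⟩
  let v : cycleWords g ν c n → W := fun ω => ⟨wordOp S (ω : List (Fin N)) (f c), hmem ω⟩
  have hv : Orthonormal ℂ v := by
    have h1 := h.orthonormal_cycleWords c n
    exact ⟨h1.1, h1.2⟩
  have hbot : (Submodule.span ℂ (Set.range v))ᗮ = ⊥ := by
    rw [Submodule.eq_bot_iff]
    intro x hx
    have hle : W ≤ (ℂ ∙ (x : H))ᗮ := by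
      refine closedSpan_le (Submodule.isClosed_orthogonal _) ?_
      rintro _ ⟨ω, hω, rfl⟩
      rw [SetLike.mem_coe, Submodule.mem_orthogonal_singleton_iff_inner_right]
      have hvω : v ⟨ω, hω⟩ ∈ Submodule.span ℂ (Set.range v) :=
        Submodule.subset_span (Set.mem_range_self _)
      have hxω : ⟪x, v ⟨ω, hω⟩⟫_ℂ = 0 := Submodule.inner_left_of_mem_orthogonal hvω hx
      exact hxω
    have h0 := Submodule.mem_orthogonal_singleton_iff_inner_right.1 (hle x.2)
    exact Subtype.ext (inner_self_eq_zero.1 h0)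
  refine ⟨HilbertBasis.mkOfOrthogonalEqBot hv hbot, fun ω => ?_⟩
  rw [HilbertBasis.coe_mkOfOrthogonalEqBot]

/-- The walk started at `c'` hits `c` almost surely. -/
theorem mem_closedSpan_hittingWords [Finite M] (h : IsWalkFamily S f g ν)
    (hirr : IsIrreducibleWalk g ν) (c c' : M) :
    f c' ∈ closedSpan ((fun ω => wordOp S ω (f c)) '' hittingWords g ν c c') := by
  classical
  let F : M → Submodule ℂ H := fun d =>
    closedSpan ((fun ω => wordOp S ω (f c)) '' hittingWords g ν c d)
  -- `y d` approximates `f d` by first-passage words of length zero or more, so at `d = c` the empty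
  -- word is allowed and the error `a c` is zero. `F c`, by contrast, uses only genuine returns.
  let y : M → H := fun d => if d = c then f c else (F d).starProjection (f d)
  let a : M → ℝ := fun d => ‖f d - y d‖ ^ 2
  -- One step of the walk followed by a first passage from the new vertex is again a first passage.
  have hmem : ∀ d, ∑ i, ν i d • S i (y (g i d)) ∈ F d := by
    refine fun d => Submodule.sum_mem _ fun i _ => ?_
    by_cases hν : ν i d = 0
    · simp [hν]
    refine Submodule.smul_mem _ _ ?_
    by_cases hc : g i d = c
    · simp only [y, hc, if_true]
      exact subset_closedSpan _ ⟨[i], singleton_mem_hittingWords hc hν, rfl⟩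
    · simp only [y, hc, if_false]
      refine closedSpan_map_le (Submodule.isClosed_topologicalClosure _) (S i) ?_
        (Submodule.starProjection_apply_mem _ _)
      rintro _ ⟨ω, hω, rfl⟩
      exact subset_closedSpan _ ⟨i :: ω, cons_mem_hittingWords hc hν hω, rfl⟩
  -- Since `f d = ∑ ν i d • S i (f (g i d))`, the approximation from `hmem` has an error that splits
  -- over the orthogonal ranges of the `S i`. The bound concerns the projection onto `F d` rather
  -- than `y d`, so it also covers `d = c`.
  have hdist : ∀ d, ‖f d - (F d).starProjection (f d)‖ ^ 2 ≤ ∑ i, ‖ν i d‖ ^ 2 * a (g i d) := by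
    intro d
    refine (pow_le_pow_left₀ (norm_nonneg _)
      (norm_sub_starProjection_le (f d) (hmem d)) 2).trans_eq ?_
    have heq : f d - ∑ i, ν i d • S i (y (g i d)) =
        ∑ i, S i (ν i d • (f (g i d) - y (g i d))) := by
      conv_lhs => rw [← h.sum_smul_apply d]
      simp [smul_sub, Finset.sum_sub_distrib]
    rw [heq, h.cuntz.norm_sq_sum_apply]
    simp only [norm_smul, mul_pow, a]
  have hac : a c = 0 := by simp [a, y]
  have ha0 : ∀ d, a d ≤ 0 := by
    intro d
    rw [← hac]
    refine hirr.le_of_subharmonic h.sum_norm_sq (fun d => ?_) c d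
    by_cases hd : d = c
    · rw [hd, hac]
      exact Finset.sum_nonneg fun i _ => mul_nonneg (sq_nonneg _) (sq_nonneg _)
    · simpa only [a, y, hd, if_false] using hdist d
  -- One further use of `hdist` passes from `y` back to `F`; this is what handles returns when `c' =
  -- c`.
  have h0 : ‖f c' - (F c').starProjection (f c')‖ ^ 2 ≤ 0 :=
    (hdist c').trans (Finset.sum_nonpos fun i _ =>
      mul_nonpos_of_nonneg_of_nonpos (sq_nonneg _) (ha0 _))
  have h1 : f c' - (F c').starProjection (f c') = 0 :=
    norm_eq_zero.1 (pow_eq_zero_iff two_ne_zero |>.1 (le_antisymm h0 (sq_nonneg _)))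
  exact Submodule.starProjection_eq_self_iff.1 (sub_eq_zero.1 h1).symm

/-- Expanding the trailing `f c` of `S_ω (f c)` over its first returns appends exactly one cycle
word to `ω`. -/
theorem cycleSpace_le_succ [Finite M] (h : IsWalkFamily S f g ν)
    (hirr : IsIrreducibleWalk g ν) (c : M) (n : ℕ) :
    cycleSpace S g ν c (f c) n ≤ cycleSpace S g ν c (f c) (n + 1) := by
  refine closedSpan_le (Submodule.isClosed_topologicalClosure _) ?_
  rintro _ ⟨ω, hω, rfl⟩
  refine closedSpan_map_le (Submodule.isClosed_topologicalClosure _) (wordOp S ω) ?_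
    (h.mem_closedSpan_hittingWords hirr c c)
  rintro _ ⟨β, hβ, rfl⟩
  exact subset_closedSpan _ ⟨ω ++ β, append_mem_cycleWords_succ hω hβ, wordOp_append _ _ _ _⟩

theorem coe_orbitSpace [Finite M] (h : IsWalkFamily S f g ν)
    (hirr : IsIrreducibleWalk g ν) (c : M) :
    (orbitSpace S (f c) : Set H) = closure (⋃ n, (cycleSpace S g ν c (f c) n : Set H)) := by
  have hmono : Monotone fun n => cycleSpace S g ν c (f c) n :=
    monotone_nat_of_le_succ (h.cycleSpace_le_succ hirr c)
  apply subset_antisymm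
  · rw [← Submodule.coe_iSup_of_directed _ hmono.directed_le, ← Submodule.topologicalClosure_coe]
    refine closedSpan_le (Submodule.isClosed_topologicalClosure _) ?_
    rw [← iUnion_cycleVectors S g ν c]
    refine Set.iUnion_subset fun n => ?_
    exact (subset_closedSpan _).trans
      ((le_iSup (fun n => cycleSpace S g ν c (f c) n) n).trans (Submodule.le_topologicalClosure _))
  · exact closure_minimal (Set.iUnion_subset fun n => cycleSpace_le_orbitSpace S g ν c _ n)
      (Submodule.isClosed_topologicalClosure _)

theorem mem_orbitSpace [Finite M] (h : IsWalkFamily S f g ν)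
    (hirr : IsIrreducibleWalk g ν) (c c' : M) : f c' ∈ orbitSpace S (f c) := by
  refine closedSpan_le (Submodule.isClosed_topologicalClosure _) ?_
    (h.mem_closedSpan_hittingWords hirr c c')
  rintro _ ⟨ω, -, rfl⟩
  exact subset_closedSpan _ ⟨ω, rfl⟩

theorem isInvariantSubspace_orbitSpace [Finite M] (h : IsWalkFamily S f g ν)
    (hirr : IsIrreducibleWalk g ν) (c : M) : IsInvariantSubspace S (orbitSpace S (f c)) := by
  constructor
  · intro i x hx
    refine closedSpan_map_le (Submodule.isClosed_topologicalClosure _) (S i) ?_ hx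
    rintro _ ⟨ω, rfl⟩
    exact subset_closedSpan _ ⟨i :: ω, rfl⟩
  · intro i x hx
    refine closedSpan_map_le (Submodule.isClosed_topologicalClosure _)
      (ContinuousLinearMap.adjoint (S i)) ?_ hx
    rintro _ ⟨ω, rfl⟩
    cases ω with
    | nil =>
      change ContinuousLinearMap.adjoint (S i) (f c) ∈ _
      rw [h.adjoint_apply]
      exact Submodule.smul_mem _ _ (h.mem_orbitSpace hirr c _)
    | cons j ω =>
      change ContinuousLinearMap.adjoint (S i) (S j (wordOp S ω (f c))) ∈ _
      by_cases hij : i = j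
      · subst hij
        rw [h.cuntz.adjoint_apply_self]
        exact subset_closedSpan _ ⟨ω, rfl⟩
      · rw [h.cuntz.adjoint_apply_of_ne hij]
        exact Submodule.zero_mem _

/-- Tested against acyclic words, appending a loop only multiplies by its conjugate weight: for `ω ≠
ω₀` both sides vanish by uniqueness of the decomposition. -/
theorem inner_wordOp_append_loop_of_acyclicWords (h : IsWalkFamily S f g ν) {c : M}
    {ω ω₀ γ : List (Fin N)} (hω : ω ∈ acyclicWords g ν c) (hω₀ : ω₀ ∈ acyclicWords g ν c)
    (hγ : IsLoop g ν c γ) :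
    ⟪wordOp S ω (f c), wordOp S (ω₀ ++ γ) (f c)⟫_ℂ =
      conj (weight g ν γ c) * ⟪wordOp S ω (f c), wordOp S ω₀ (f c)⟫_ℂ := by
  by_cases heq : ω = ω₀
  · subst heq
    have h1 := h.inner_wordOp_append_loop ω (IsLoop.nil (g := g) (ν := ν) (c := c))
    rw [List.append_nil] at h1
    rw [h.inner_wordOp_append_loop ω hγ, h1]
    simp [weight]
  · have key : ∀ γ', IsLoop g ν c γ' →
        ⟪wordOp S ω (f c), wordOp S (ω₀ ++ γ') (f c)⟫_ℂ = 0 := by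
      intro γ' hγ'
      by_contra hne
      rcases h.exists_loop_of_inner_ne_zero hne with ⟨δ, hδ, hδeq⟩ | ⟨δ, hδ, hδeq⟩
      · exact heq (eq_of_acyclicWords_append_loop h.injective hω hω₀ hδ hγ' hδeq.symm).1
      · rw [List.append_assoc] at hδeq
        have h0 := (hγ'.append hδ).eq_nil_of_acyclicWords (hδeq ▸ hω)
        rw [h0, List.append_nil] at hδeq
        exact heq hδeq
    have h0 := key [] IsLoop.nil
    rw [List.append_nil] at h0
    rw [key γ hγ, h0, mul_zero]

/-- A vector whose coefficients are compatible with appending loops has the same projections on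
`cycleSpace S g ν c (f c) 0` and on `orbitSpace S (f c)`. -/
theorem sub_starProjection_mem_orthogonal (h : IsWalkFamily S f g ν) {c : M} {y : H}
    (hy : ∀ ω γ, IsLoop g ν c γ → ⟪wordOp S (ω ++ γ) (f c), y⟫_ℂ =
      weight g ν γ c * ⟪wordOp S ω (f c), y⟫_ℂ) :
    y - (cycleSpace S g ν c (f c) 0).starProjection y ∈ (orbitSpace S (f c))ᗮ := by
  set W := cycleSpace S g ν c (f c) 0 with hW
  rw [Submodule.mem_orthogonal']
  suffices hle : orbitSpace S (f c) ≤ (ℂ ∙ (y - W.starProjection y))ᗮ from fun x hx =>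
    Submodule.mem_orthogonal_singleton_iff_inner_right.1 (hle hx)
  refine closedSpan_le (Submodule.isClosed_orthogonal _) ?_
  rintro _ ⟨ω, rfl⟩
  rw [SetLike.mem_coe, Submodule.mem_orthogonal_singleton_iff_inner_left]
  obtain ⟨ω₀, γ, hω₀, hγ, rfl⟩ := exists_acyclicWords_append_loop (g := g) (ν := ν) (c := c) ω
  have hmem : wordOp S ω₀ (f c) ∈ W :=
    subset_closedSpan _ ⟨ω₀, by rwa [cycleWords_zero], rfl⟩
  -- This identifies the projection of `S_{ω₀γ} (f c)` onto `W`. Hence the projection of `y` obeys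
  -- the same loop relation as `y`, and the comparison reduces to acyclic words.
  have horth : wordOp S (ω₀ ++ γ) (f c) - conj (weight g ν γ c) • wordOp S ω₀ (f c) ∈ Wᗮ := by
    rw [Submodule.mem_orthogonal']
    suffices hle : W ≤ (ℂ ∙ (wordOp S (ω₀ ++ γ) (f c) -
        conj (weight g ν γ c) • wordOp S ω₀ (f c)))ᗮ from fun x hx =>
      Submodule.mem_orthogonal_singleton_iff_inner_right.1 (hle hx)
    refine closedSpan_le (Submodule.isClosed_orthogonal _) ?_
    rintro _ ⟨ω, hω, rfl⟩
    rw [cycleWords_zero] at hω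
    rw [SetLike.mem_coe, Submodule.mem_orthogonal_singleton_iff_inner_left, inner_sub_right,
      inner_smul_right, h.inner_wordOp_append_loop_of_acyclicWords hω hω₀ hγ, sub_self]
  have h1 : ⟪wordOp S (ω₀ ++ γ) (f c), W.starProjection y⟫_ℂ =
      weight g ν γ c * ⟪wordOp S ω₀ (f c), W.starProjection y⟫_ℂ := by
    have h2 := Submodule.inner_left_of_mem_orthogonal
      (Submodule.starProjection_apply_mem W y) horth
    rw [inner_sub_left, inner_smul_left, Complex.conj_conj, sub_eq_zero] at h2
    exact h2
  have h3 : ⟪wordOp S ω₀ (f c), y - W.starProjection y⟫_ℂ = 0 :=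
    Submodule.inner_right_of_mem_orthogonal hmem
      (Submodule.sub_starProjection_mem_orthogonal (K := W) y)
  rw [inner_sub_right, sub_eq_zero] at h3
  rw [inner_sub_right, hy ω₀ γ hγ, h1, h3, sub_self]

end IsWalkFamily

end WalkFamily

/-! ### Dilations, fixed points and irreducibility -/

section Invariant

variable {N : ℕ} {H : Type*} [NormedAddCommGroup H] [InnerProductSpace ℂ H] [CompleteSpace H]

theorem starProjection_apply_comm {W : Submodule ℂ H} [W.HasOrthogonalProjection]
    {A : H →L[ℂ] H} (hA : ∀ x ∈ W, A x ∈ W)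
    (hA' : ∀ x ∈ W, ContinuousLinearMap.adjoint A x ∈ W) (x : H) :
    W.starProjection (A x) = A (W.starProjection x) := by
  refine Submodule.eq_starProjection_of_mem_orthogonal
    (hA _ (Submodule.starProjection_apply_mem _ _)) ?_
  rw [← map_sub, Submodule.mem_orthogonal]
  intro w hw
  rw [← ContinuousLinearMap.adjoint_inner_left]
  exact Submodule.inner_right_of_mem_orthogonal (hA' w hw)
    (Submodule.sub_starProjection_mem_orthogonal (K := W) x)

theorem IsInvariantSubspace.starProjection_comm {S : Fin N → H →L[ℂ] H} {W : Submodule ℂ H}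
    [W.HasOrthogonalProjection] (hW : IsInvariantSubspace S W) (i : Fin N) (x : H) :
    W.starProjection (S i x) = S i (W.starProjection x) :=
  starProjection_apply_comm (hW.1 i) (hW.2 i) x

theorem IsInvariantSubspace.starProjection_adjoint_comm {S : Fin N → H →L[ℂ] H}
    {W : Submodule ℂ H} [W.HasOrthogonalProjection] (hW : IsInvariantSubspace S W) (i : Fin N)
    (x : H) :
    W.starProjection (ContinuousLinearMap.adjoint (S i) x) =
      ContinuousLinearMap.adjoint (S i) (W.starProjection x) :=
  starProjection_apply_comm (hW.2 i)
    (by rw [ContinuousLinearMap.adjoint_adjoint]; exact hW.1 i) x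

theorem IsCuntzRep.sum_inner_adjoint {S : Fin N → H →L[ℂ] H} (hS : IsCuntzRep S) (x y : H) :
    ∑ i, ⟪ContinuousLinearMap.adjoint (S i) x, ContinuousLinearMap.adjoint (S i) y⟫_ℂ =
      ⟪x, y⟫_ℂ := by
  rw [← hS.inner_sum_apply, hS.sum_apply, hS.sum_apply]

/-- The map `B ↦ ∑ i, S i B (S i)*`. -/
noncomputable def conjSum (S : Fin N → H →L[ℂ] H) (B : H →L[ℂ] H) : H →L[ℂ] H :=
  ∑ i, S i ∘L B ∘L ContinuousLinearMap.adjoint (S i)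

theorem inner_conjSum (S : Fin N → H →L[ℂ] H) (B : H →L[ℂ] H) (x y : H) :
    ⟪x, conjSum S B y⟫_ℂ = ∑ i, ⟪ContinuousLinearMap.adjoint (S i) x,
      B (ContinuousLinearMap.adjoint (S i) y)⟫_ℂ := by
  simp [conjSum, ContinuousLinearMap.adjoint_inner_left]

/-- The ranges of the `S i` are orthogonal, so bounds are preserved without a factor `N`. This keeps
the iterates of `conjSum S` uniformly bounded. -/
theorem IsCuntzRep.norm_conjSum_apply_le {S : Fin N → H →L[ℂ] H} (hS : IsCuntzRep S)
    {B : H →L[ℂ] H} {C : ℝ} (hC : 0 ≤ C) (hB : ∀ y, ‖B y‖ ≤ C * ‖y‖) (y : H) :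
    ‖conjSum S B y‖ ≤ C * ‖y‖ := by
  refine le_of_sq_le_sq ?_ (mul_nonneg hC (norm_nonneg _))
  have h1 : conjSum S B y = ∑ i, S i (B (ContinuousLinearMap.adjoint (S i) y)) := by
    simp [conjSum]
  rw [h1, hS.norm_sq_sum_apply, mul_pow, ← hS.sum_norm_sq_adjoint y, Finset.mul_sum]
  refine Finset.sum_le_sum fun i _ => ?_
  rw [← mul_pow]
  exact pow_le_pow_left₀ (norm_nonneg _) (hB _) 2

end Invariant

section Dilation

variable {N : ℕ}
  {K : Type*} [NormedAddCommGroup K] [InnerProductSpace ℂ K] [CompleteSpace K]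
  {H : Type*} [NormedAddCommGroup H] [InnerProductSpace ℂ H] [CompleteSpace H]
  {V : Fin N → K →L[ℂ] K} {S : Fin N → H →L[ℂ] H} {J : K →ₗᵢ[ℂ] H}

/-- An operator in the commutant of a Cuntz dilation is determined by its compression. -/
theorem IsCuntzDilation.eq_zero_of_comm (hS : IsCuntzDilation V S J) {A : H →L[ℂ] H}
    (hA : ∀ i x, A (S i x) = S i (A x))
    (hA' : ∀ i x, A (ContinuousLinearMap.adjoint (S i) x) = ContinuousLinearMap.adjoint (S i) (A x))
    (h0 : ∀ k k', ⟪J k, A (J k')⟫_ℂ = 0) : A = 0 := by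
  -- Letters of `w` pass through `A` and act on `J k` as adjoints, which keep it in the range of
  -- `J`.
  have h1 : ∀ (w : List (Fin N)) (k k' : K), ⟪J k, A (wordOp S w (J k'))⟫_ℂ = 0 := by
    intro w
    induction w with
    | nil => exact h0
    | cons i w ih =>
      intro k k'
      change ⟪J k, A (S i (wordOp S w (J k')))⟫_ℂ = 0
      rw [hA, ← ContinuousLinearMap.adjoint_inner_left, hS.adjoint_apply]
      exact ih _ _
  -- The first letter of `u` passes through `A` as an adjoint. It then cancels the first letter of
  -- `w`, kills the vector, or, when `w` is empty, acts inside the range of `J`.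
  have h2 : ∀ (u w : List (Fin N)) (k k' : K),
      ⟪wordOp S u (J k), A (wordOp S w (J k'))⟫_ℂ = 0 := by
    intro u
    induction u with
    | nil => exact h1
    | cons i u ih =>
      intro w k k'
      change ⟪S i (wordOp S u (J k)), A (wordOp S w (J k'))⟫_ℂ = 0
      rw [← ContinuousLinearMap.adjoint_inner_right, ← hA']
      cases w with
      | nil =>
        change ⟪wordOp S u (J k), A (ContinuousLinearMap.adjoint (S i) (J k'))⟫_ℂ = 0
        rw [hS.adjoint_apply]
        exact ih [] _ _
      | cons j w =>
        change ⟪wordOp S u (J k), A (ContinuousLinearMap.adjoint (S i)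
          (S j (wordOp S w (J k'))))⟫_ℂ = 0
        by_cases hij : i = j
        · subst hij
          rw [hS.cuntz.adjoint_apply_self]
          exact ih w _ _
        · rw [hS.cuntz.adjoint_apply_of_ne hij, map_zero, inner_zero_right]
  have hcl : closedSpan (Set.range fun p : List (Fin N) × K => wordOp S p.1 (J p.2)) = ⊤ := by
    refine hS.cyclic _ (Submodule.isClosed_topologicalClosure _) ⟨?_, ?_⟩ ?_
    · intro i x hx
      refine closedSpan_map_le (Submodule.isClosed_topologicalClosure _) (S i) ?_ hx
      rintro _ ⟨⟨w, k⟩, rfl⟩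
      exact subset_closedSpan _ ⟨(i :: w, k), rfl⟩
    · intro i x hx
      refine closedSpan_map_le (Submodule.isClosed_topologicalClosure _)
        (ContinuousLinearMap.adjoint (S i)) ?_ hx
      rintro _ ⟨⟨w, k⟩, rfl⟩
      cases w with
      | nil =>
        exact subset_closedSpan _ ⟨([], ContinuousLinearMap.adjoint (V i) k),
          (hS.adjoint_apply i k).symm⟩
      | cons j w =>
        change ContinuousLinearMap.adjoint (S i) (S j (wordOp S w (J k))) ∈ _
        by_cases hij : i = j
        · subst hij
          rw [hS.cuntz.adjoint_apply_self]
          exact subset_closedSpan _ ⟨(w, k), rfl⟩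
        · rw [hS.cuntz.adjoint_apply_of_ne hij]
          exact Submodule.zero_mem _
    · exact fun k => subset_closedSpan _ ⟨([], k), rfl⟩
  have h3 : ∀ (u : List (Fin N)) (k : K) (x : H), ⟪wordOp S u (J k), A x⟫_ℂ = 0 := by
    intro u k x
    have hx : x ∈ closedSpan (Set.range fun p : List (Fin N) × K => wordOp S p.1 (J p.2)) := by
      rw [hcl]
      trivial
    have h4 : A x ∈ (ℂ ∙ wordOp S u (J k))ᗮ := by
      refine closedSpan_map_le (Submodule.isClosed_orthogonal _) A ?_ hx
      rintro _ ⟨⟨w, k'⟩, rfl⟩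
      exact Submodule.mem_orthogonal_singleton_iff_inner_right.2 (h2 u w k k')
    exact Submodule.mem_orthogonal_singleton_iff_inner_right.1 h4
  ext x
  have h5 : A x ∈ (ℂ ∙ A x)ᗮ := by
    have hle : closedSpan (Set.range fun p : List (Fin N) × K => wordOp S p.1 (J p.2)) ≤
        (ℂ ∙ A x)ᗮ := by
      refine closedSpan_le (Submodule.isClosed_orthogonal _) ?_
      rintro _ ⟨⟨u, k⟩, rfl⟩
      exact Submodule.mem_orthogonal_singleton_iff_inner_left.2 (h3 u k x)
    rw [hcl] at hle
    exact hle trivial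
  exact inner_self_eq_zero.1 (Submodule.mem_orthogonal_singleton_iff_inner_right.1 h5)

/-- Compression to `K` intertwines the two maps because the range of `J` is coinvariant. -/
theorem IsCuntzDilation.inner_conjSum_eq (hS : IsCuntzDilation V S J) {B : H →L[ℂ] H}
    {T : K →L[ℂ] K} (h : ∀ k k', ⟪J k, B (J k')⟫_ℂ = ⟪k, T k'⟫_ℂ) (k k' : K) :
    ⟪J k, conjSum S B (J k')⟫_ℂ = ⟪k, conjSum V T k'⟫_ℂ := by
  simp only [inner_conjSum, hS.adjoint_apply, h]

/-- If the only fixed points of `T ↦ ∑ i, V i T (V i)*` are scalar then the dilation is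
irreducible. -/
theorem IsCuntzDilation.isIrreducibleRep (hS : IsCuntzDilation V S J) [Nontrivial H]
    (hfix : ∀ T : K →L[ℂ] K, conjSum V T = T → ∃ z : ℂ, T = z • ContinuousLinearMap.id ℂ K) :
    IsIrreducibleRep S := by
  refine ⟨inferInstance, fun W hW hinv => ?_⟩
  have : CompleteSpace W := hW.completeSpace_coe
  set Q := W.starProjection with hQ
  let T : K →L[ℂ] K :=
    ContinuousLinearMap.adjoint J.toContinuousLinearMap ∘L Q ∘L J.toContinuousLinearMap
  have hT : ∀ k k', ⟪J k, Q (J k')⟫_ℂ = ⟪k, T k'⟫_ℂ := by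
    intro k k'
    simp [T, ContinuousLinearMap.adjoint_inner_right]
  have hQfix : ∀ x y, ⟪x, conjSum S Q y⟫_ℂ = ⟪x, Q y⟫_ℂ := by
    intro x y
    rw [inner_conjSum, ← hS.cuntz.sum_inner_adjoint x (Q y)]
    simp only [hQ, hinv.starProjection_adjoint_comm]
  obtain ⟨z, hz⟩ := hfix T (by
    ext k'
    refine ext_inner_left ℂ fun k => ?_
    rw [← hS.inner_conjSum_eq hT, hQfix, hT])
  have h0 : Q - z • ContinuousLinearMap.id ℂ H = 0 := by
    refine hS.eq_zero_of_comm (fun i x => ?_) (fun i x => ?_) fun k k' => ?_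
    · simp [hQ, hinv.starProjection_comm]
    · simp [hQ, hinv.starProjection_adjoint_comm]
    · simp [hT, hz]
  -- A projection that is a scalar: `z = 0` gives `W = ⊥`, and otherwise dividing by `z` puts every
  -- vector in `W`.
  have hQz : ∀ x, Q x = z • x := fun x => by
    simpa [sub_eq_zero] using DFunLike.congr_fun h0 x
  by_cases hz0 : z = 0
  · left
    rw [Submodule.eq_bot_iff]
    intro x hx
    rw [← Submodule.starProjection_eq_self_iff.2 hx, ← hQ, hQz, hz0, zero_smul]
  · right
    rw [Submodule.eq_top_iff']
    intro x
    have h1 : z⁻¹ • Q x = x := by rw [hQz, inv_smul_smul₀ hz0]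
    rw [← h1]
    exact W.smul_mem _ (Submodule.starProjection_apply_mem _ _)

/-- The vectors `x` such that `(S ω)* x` lies in `E` for all words `ω` of length `n`. -/
noncomputable def adjointPreimage (S : Fin N → H →L[ℂ] H) (E : Submodule ℂ H) : ℕ → Submodule ℂ H
  | 0 => E
  | n + 1 => ⨅ i, (adjointPreimage S E n).comap (ContinuousLinearMap.adjoint (S i) : H →ₗ[ℂ] H)

theorem mem_adjointPreimage_succ {E : Submodule ℂ H} {n : ℕ} {x : H} :
    x ∈ adjointPreimage S E (n + 1) ↔
      ∀ i, ContinuousLinearMap.adjoint (S i) x ∈ adjointPreimage S E n := by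
  simp [adjointPreimage, Submodule.mem_iInf]

theorem adjointPreimage_monotone {E : Submodule ℂ H}
    (hE : ∀ i, ∀ x ∈ E, ContinuousLinearMap.adjoint (S i) x ∈ E) :
    Monotone (adjointPreimage S E) := by
  refine monotone_nat_of_le_succ fun n => ?_
  induction n with
  | zero => exact fun x hx => mem_adjointPreimage_succ.2 fun i => hE i x hx
  | succ n ih =>
    exact fun x hx => mem_adjointPreimage_succ.2 fun i => ih (mem_adjointPreimage_succ.1 hx i)

theorem IsCuntzRep.wordOp_mem_adjointPreimage (hS : IsCuntzRep S) {E : Submodule ℂ H} {x : H}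
    (hx : x ∈ E) (ω : List (Fin N)) : wordOp S ω x ∈ adjointPreimage S E ω.length := by
  induction ω with
  | nil => exact hx
  | cons j ω ih =>
    refine mem_adjointPreimage_succ.2 fun i => ?_
    change ContinuousLinearMap.adjoint (S i) (S j (wordOp S ω x)) ∈ _
    by_cases hij : i = j
    · subst hij
      rwa [hS.adjoint_apply_self]
    · rw [hS.adjoint_apply_of_ne hij]
      exact Submodule.zero_mem _

/-- After `n` adjoint steps both vectors lie in `E`, where the form of `B` vanishes. -/
theorem inner_iterate_conjSum_eq_zero {E : Submodule ℂ H} {B : H →L[ℂ] H}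
    (hB : ∀ x ∈ E, ∀ y ∈ E, ⟪x, B y⟫_ℂ = 0) {n : ℕ} {x y : H}
    (hx : x ∈ adjointPreimage S E n) (hy : y ∈ adjointPreimage S E n) :
    ⟪x, (conjSum S)^[n] B y⟫_ℂ = 0 := by
  induction n generalizing x y with
  | zero => exact hB x hx y hy
  | succ n ih =>
    rw [Function.iterate_succ_apply', inner_conjSum]
    exact Finset.sum_eq_zero fun i _ =>
      ih (mem_adjointPreimage_succ.1 hx i) (mem_adjointPreimage_succ.1 hy i)

/-- A fixed point of `T ↦ ∑ i, V i T (V i)*` is determined by its compression to a coinvariant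
subspace containing a vector whose orbit spans the dilation. -/
theorem IsCuntzDilation.eq_zero_of_conjSum_eq (hS : IsCuntzDilation V S J) {K₀ : Submodule ℂ K}
    (hK₀ : ∀ i, ∀ x ∈ K₀, ContinuousLinearMap.adjoint (V i) x ∈ K₀) {x₀ : K} (hx₀ : x₀ ∈ K₀)
    (htop : orbitSpace S (J x₀) = ⊤) {T : K →L[ℂ] K} (hT : conjSum V T = T)
    (h0 : ∀ k ∈ K₀, ∀ k' ∈ K₀, ⟪k, T k'⟫_ℂ = 0) : T = 0 := by
  -- The lift of `T` by zero off `K`. Its iterates under `conjSum S` all compress to `T` (`hcomp`),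
  -- are bounded by `‖T‖` (`hnorm`), and vanish as forms on ever larger subspaces whose union is
  -- dense; no limit operator is needed.
  set B : H →L[ℂ] H := J.toContinuousLinearMap ∘L T ∘L
    ContinuousLinearMap.adjoint J.toContinuousLinearMap with hB
  have hJJ : ∀ k, ContinuousLinearMap.adjoint J.toContinuousLinearMap (J k) = k := by
    intro k
    refine ext_inner_left ℂ fun k' => ?_
    rw [ContinuousLinearMap.adjoint_inner_right]
    exact J.inner_map_map k' k
  have hBJ : ∀ k k', ⟪J k, B (J k')⟫_ℂ = ⟪k, T k'⟫_ℂ := by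
    intro k k'
    simp [hB, hJJ]
  have hcomp : ∀ (n : ℕ) k k', ⟪J k, (conjSum S)^[n] B (J k')⟫_ℂ = ⟪k, T k'⟫_ℂ := by
    intro n
    induction n with
    | zero => exact hBJ
    | succ n ih =>
      intro k k'
      rw [Function.iterate_succ_apply', hS.inner_conjSum_eq ih, hT]
  have hnorm : ∀ (n : ℕ) y, ‖(conjSum S)^[n] B y‖ ≤ ‖T‖ * ‖y‖ := by
    intro n
    induction n with
    | zero =>
      intro y
      have h1 : ‖B y‖ = ‖T (ContinuousLinearMap.adjoint J.toContinuousLinearMap y)‖ := by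
        simp [hB]
      have h2 : ‖ContinuousLinearMap.adjoint J.toContinuousLinearMap y‖ ≤ ‖y‖ := by
        refine (ContinuousLinearMap.le_opNorm _ _).trans ?_
        rw [LinearIsometryEquiv.norm_map]
        exact mul_le_of_le_one_left (norm_nonneg _) J.norm_toContinuousLinearMap_le
      change ‖B y‖ ≤ _
      rw [h1]
      exact (T.le_opNorm _).trans (mul_le_mul_of_nonneg_left h2 (norm_nonneg _))
    | succ n ih =>
      rw [Function.iterate_succ_apply']
      exact hS.cuntz.norm_conjSum_apply_le (norm_nonneg _) ih
  set E : Submodule ℂ H := K₀.map (J.toLinearMap) with hE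
  have hEinv : ∀ i, ∀ x ∈ E, ContinuousLinearMap.adjoint (S i) x ∈ E := by
    rintro i _ ⟨k, hk, rfl⟩
    exact ⟨_, hK₀ i k hk, (hS.adjoint_apply i k).symm⟩
  have hE0 : ∀ x ∈ E, ∀ y ∈ E, ⟪x, B y⟫_ℂ = 0 := by
    rintro _ ⟨k, hk, rfl⟩ _ ⟨k', hk', rfl⟩
    exact (hBJ k k').trans (h0 k hk k' hk')
  have hmono := adjointPreimage_monotone (S := S) hEinv
  have hdense : ∀ x : H, ∃ y : ℕ → H, (∀ m, ∃ n, y m ∈ adjointPreimage S E n) ∧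
      Filter.Tendsto y Filter.atTop (nhds x) := by
    intro x
    have hx : x ∈ (⨆ n, adjointPreimage S E n).topologicalClosure := by
      have hle : orbitSpace S (J x₀) ≤ (⨆ n, adjointPreimage S E n).topologicalClosure := by
        refine Submodule.topologicalClosure_mono (Submodule.span_le.2 ?_)
        rintro _ ⟨ω, rfl⟩
        exact (le_iSup (adjointPreimage S E) ω.length)
          (hS.cuntz.wordOp_mem_adjointPreimage (Submodule.mem_map_of_mem hx₀) ω)
      rw [htop] at hle
      exact hle trivial
    obtain ⟨y, hy, hlim⟩ := mem_closure_iff_seq_limit.1 hx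
    exact ⟨y, fun m => (Submodule.mem_iSup_of_directed _ hmono.directed_le).1 (hy m), hlim⟩
  ext k'
  refine ext_inner_left ℂ fun k => ?_
  rw [zero_apply, inner_zero_right, ← norm_le_zero_iff]
  obtain ⟨y, hy, hylim⟩ := hdense (J k)
  obtain ⟨y', hy', hylim'⟩ := hdense (J k')
  -- The error bound involves `‖T‖` alone, so the iterate may vary with `m`.
  have hlim : Filter.Tendsto (fun m => ‖J k - y m‖ * (‖T‖ * ‖J k'‖) +
      ‖y m‖ * (‖T‖ * ‖J k' - y' m‖)) Filter.atTop (nhds 0) := by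
    have h1 := ((tendsto_const_nhds (x := J k)).sub hylim).norm.mul_const (‖T‖ * ‖J k'‖)
    have h2 := hylim.norm.mul (((tendsto_const_nhds (x := J k')).sub hylim').norm.const_mul ‖T‖)
    simpa using h1.add h2
  refine ge_of_tendsto' hlim fun m => ?_
  obtain ⟨n, hn⟩ := hy m
  obtain ⟨n', hn'⟩ := hy' m
  -- The subspaces increase, so a single exponent serves both approximants.
  set A := (conjSum S)^[max n n'] B with hA
  have hz : ⟪y m, A (y' m)⟫_ℂ = 0 := inner_iterate_conjSum_eq_zero hE0
    (hmono (le_max_left n n') hn) (hmono (le_max_right n n') hn')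
  have hsplit : ⟪k, T k'⟫_ℂ = ⟪J k - y m, A (J k')⟫_ℂ + ⟪y m, A (J k' - y' m)⟫_ℂ := by
    rw [← hcomp (max n n') k k', map_sub, inner_sub_left, inner_sub_right, hz]
    ring
  rw [hsplit]
  refine (norm_add_le _ _).trans (add_le_add ?_ ?_)
  · exact (norm_inner_le_norm _ _).trans (mul_le_mul_of_nonneg_left (hnorm _ _) (norm_nonneg _))
  · exact (norm_inner_le_norm _ _).trans (mul_le_mul_of_nonneg_left (hnorm _ _) (norm_nonneg _))

end Dilation

/-! ### Compressions to a coinvariant subspace and their fixed points -/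

section Compress

variable {N : ℕ} {K : Type*} [NormedAddCommGroup K] [InnerProductSpace ℂ K] [CompleteSpace K]
  (K₀ : Submodule ℂ K) [CompleteSpace K₀]

omit [CompleteSpace K] in
theorem inner_compress (A : K →L[ℂ] K) (x y : K₀) :
    ⟪x, compress K₀ A y⟫_ℂ = ⟪(x : K), A y⟫_ℂ := by
  simp only [compress, ContinuousLinearMap.comp_apply]
  exact Submodule.inner_orthogonalProjectionOnto_eq_of_mem_left x _

theorem adjoint_compress (A : K →L[ℂ] K) :
    ContinuousLinearMap.adjoint (compress K₀ A) =
      compress K₀ (ContinuousLinearMap.adjoint A) := by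
  symm
  rw [ContinuousLinearMap.eq_adjoint_iff]
  intro x y
  rw [inner_compress, ← inner_conj_symm, inner_compress,
    ContinuousLinearMap.adjoint_inner_right, inner_conj_symm]

variable {K₀}

omit [CompleteSpace K] in
theorem coe_compress_apply {A : K →L[ℂ] K} {x : K₀} (h : A x ∈ K₀) :
    (compress K₀ A x : K) = A x :=
  Submodule.starProjection_eq_self_iff.2 h

theorem coe_adjoint_compress_apply {A : K →L[ℂ] K} {x : K₀}
    (h : ContinuousLinearMap.adjoint A x ∈ K₀) :
    (ContinuousLinearMap.adjoint (compress K₀ A) x : K) = ContinuousLinearMap.adjoint A x := by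
  rw [adjoint_compress, coe_compress_apply h]

theorem compress_sum_extendZero (V : Fin N → K →L[ℂ] K) (T : K₀ →L[ℂ] K₀) :
    compress K₀ (∑ i, V i ∘L extendZero K₀ T ∘L ContinuousLinearMap.adjoint (V i)) =
      conjSum (fun i => compress K₀ (V i)) T := by
  ext x
  simp only [conjSum, adjoint_compress]
  simp [compress, extendZero, map_sum]

theorem isRowCoisometry_compress {V : Fin N → K →L[ℂ] K} (hV : IsRowCoisometry V)
    (h : ∀ i, ∀ x ∈ K₀, ContinuousLinearMap.adjoint (V i) x ∈ K₀) :
    IsRowCoisometry fun i => compress K₀ (V i) := by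
  ext x
  congr 1
  refine ext_inner_left ℂ fun y => ?_
  have h1 := DFunLike.congr_fun hV (x : K)
  simp only [_root_.sum_apply, ContinuousLinearMap.comp_apply,
    ContinuousLinearMap.id_apply] at h1 ⊢
  rw [inner_sum, Submodule.coe_inner, ← h1, inner_sum]
  refine Finset.sum_congr rfl fun i _ => ?_
  rw [inner_compress, coe_adjoint_compress_apply (h i x x.2)]

theorem conjSum_compress {V : Fin N → K →L[ℂ] K}
    (h : ∀ i, ∀ x ∈ K₀, ContinuousLinearMap.adjoint (V i) x ∈ K₀) {T : K →L[ℂ] K}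
    (hT : conjSum V T = T) :
    conjSum (fun i => compress K₀ (V i)) (compress K₀ T) = compress K₀ T := by
  refine ContinuousLinearMap.ext fun x => ext_inner_left ℂ fun y => ?_
  rw [inner_conjSum, inner_compress]
  conv_rhs => rw [← hT]
  rw [inner_conjSum]
  refine Finset.sum_congr rfl fun i _ => ?_
  rw [inner_compress, coe_adjoint_compress_apply (h i x x.2),
    coe_adjoint_compress_apply (h i y y.2)]

theorem conjSum_smul_id {V : Fin N → K →L[ℂ] K} (hV : IsRowCoisometry V) (z : ℂ) :
    conjSum V (z • ContinuousLinearMap.id ℂ K) = z • ContinuousLinearMap.id ℂ K := by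
  conv_rhs => rw [← hV, Finset.smul_sum]
  refine Finset.sum_congr rfl fun i _ => ?_
  ext x
  simp

theorem conjSum_sub (V : Fin N → K →L[ℂ] K) (A B : K →L[ℂ] K) :
    conjSum V (A - B) = conjSum V A - conjSum V B := by
  simp only [conjSum, ← Finset.sum_sub_distrib]
  refine Finset.sum_congr rfl fun i _ => ?_
  ext x
  simp

theorem IsSimpleOn.exists_eq_smul_id {V : Fin N → K →L[ℂ] K} (hsimple : IsSimpleOn V K₀)
    {T : K₀ →L[ℂ] K₀} (hT : conjSum (fun i => compress K₀ (V i)) T = T) :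
    ∃ z : ℂ, T = z • ContinuousLinearMap.id ℂ K₀ :=
  hsimple T ((compress_sum_extendZero V T).trans hT)

end Compress

/-! ### Restrictions of representations to invariant subspaces -/

section Restrict

variable {N : ℕ} {H : Type*} [NormedAddCommGroup H] [InnerProductSpace ℂ H] [CompleteSpace H]
  {W : Submodule ℂ H}

/-- The restriction of an operator to an invariant subspace. -/
noncomputable def restrictOp (A : H →L[ℂ] H) (h : ∀ x ∈ W, A x ∈ W) : W →L[ℂ] W :=
  (A ∘L W.subtypeL).codRestrict W fun x => h x x.2

variable [CompleteSpace W]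

theorem coe_adjoint_restrictOp {A : H →L[ℂ] H} (h : ∀ x ∈ W, A x ∈ W)
    (h' : ∀ x ∈ W, ContinuousLinearMap.adjoint A x ∈ W) (x : W) :
    (ContinuousLinearMap.adjoint (restrictOp A h) x : H) = ContinuousLinearMap.adjoint A x := by
  have heq : restrictOp (ContinuousLinearMap.adjoint A) h' =
      ContinuousLinearMap.adjoint (restrictOp A h) := by
    rw [ContinuousLinearMap.eq_adjoint_iff]
    intro x y
    exact ContinuousLinearMap.adjoint_inner_left A (y : H) (x : H)
  rw [← heq]
  rfl

theorem IsCuntzRep.restrictOp {S : Fin N → H →L[ℂ] H} (hS : IsCuntzRep S)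
    (hW : IsInvariantSubspace S W) : IsCuntzRep fun i => restrictOp (S i) (hW.1 i) where
  isometry i := by
    ext x
    exact (coe_adjoint_restrictOp (hW.1 i) (hW.2 i) _).trans (hS.adjoint_apply_self i x)
  orthogonal i j hij := by
    ext x
    exact (coe_adjoint_restrictOp (hW.1 i) (hW.2 i) _).trans (hS.adjoint_apply_of_ne hij (x : H))
  sum_eq := by
    ext x
    simp only [_root_.sum_apply, ContinuousLinearMap.comp_apply,
      ContinuousLinearMap.id_apply, Submodule.coe_sum]
    rw [← hS.sum_apply (x : H)]
    refine Finset.sum_congr rfl fun i _ => ?_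
    exact congrArg (S i) (coe_adjoint_restrictOp (hW.1 i) (hW.2 i) x)

theorem IsIrreducibleRep.of_restrictOp_top {S : Fin N → H →L[ℂ] H} {W : Submodule ℂ H}
    [CompleteSpace W] (htop : W = ⊤) {S' : Fin N → W →L[ℂ] W} (hS' : ∀ i x, (S' i x : H) = S i x)
    (hirr : IsIrreducibleRep S') : IsIrreducibleRep S := by
  have hadj : ∀ i (x : W),
      (ContinuousLinearMap.adjoint (S' i) x : H) = ContinuousLinearMap.adjoint (S i) x := by
    intro i x
    have hinv : ∀ x ∈ W, S i x ∈ W := fun x _ => htop ▸ trivial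
    have h1 : S' i = CuntzWalk.restrictOp (S i) hinv :=
      ContinuousLinearMap.ext fun x => Subtype.ext (hS' i x)
    rw [h1]
    exact coe_adjoint_restrictOp hinv (fun x _ => htop ▸ trivial) x
  have hmem : ∀ x, x ∈ W := fun x => htop ▸ trivial
  obtain ⟨⟨x, y, hxy⟩, hsub⟩ := hirr
  refine ⟨⟨x, y, fun h => hxy (Subtype.ext h)⟩, fun U hU hinv => ?_⟩
  have hinvW : IsInvariantSubspace S' (U.comap (W.subtypeL : W →ₗ[ℂ] H)) := by
    refine ⟨fun i x hx => ?_, fun i x hx => ?_⟩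
    · change (S' i x : H) ∈ U
      rw [hS']
      exact hinv.1 i x hx
    · change (ContinuousLinearMap.adjoint (S' i) x : H) ∈ U
      rw [hadj]
      exact hinv.2 i x hx
  rcases hsub _ (isClosed_comap hU W.subtypeL) hinvW with h | h
  · left
    rw [Submodule.eq_bot_iff] at h ⊢
    exact fun x hx => congrArg Subtype.val (h ⟨x, hmem x⟩ hx)
  · right
    rw [Submodule.eq_top_iff'] at h ⊢
    exact fun x => h ⟨x, hmem x⟩

end Restrict

/-! ### Random walks inside a Cuntz dilation -/

section Reversing

variable {N : ℕ} {M : Type*} [Fintype M]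
  {K : Type*} [NormedAddCommGroup K] [InnerProductSpace ℂ K] [CompleteSpace K]
  {V : Fin N → K →L[ℂ] K} {K₀ : Submodule ℂ K} {e : OrthonormalBasis M ℂ K₀}
  {g : Fin N → M → M} {ν : Fin N → M → ℂ}

omit [CompleteSpace K] in
-- For a loop this says that `e c` is an eigenvector of `V_γ`, the source of the loop relation
-- needed for the projections.
theorem IsReversing.wordOp_apply (hrev : IsReversing V e g ν) {γ : List (Fin N)} {c : M}
    (h : weight g ν γ c ≠ 0) :
    wordOp V γ (e (walk g γ c) : K) = conj (weight g ν γ c) • (e c : K) := by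
  induction γ generalizing c with
  | nil => simp [wordOp, walk, weight]
  | cons i γ ih =>
    have h1 := ih (right_ne_zero_of_mul h)
    change V i (wordOp V γ (e (walk g γ (g i c)) : K)) = _
    rw [h1, map_smul, hrev i c (left_ne_zero_of_mul h), smul_smul, weight, map_mul, mul_comm]

end Reversing

section DilationWalk

variable {N : ℕ} {M : Type*}
  {K : Type*} [NormedAddCommGroup K] [InnerProductSpace ℂ K] [CompleteSpace K]
  {H : Type*} [NormedAddCommGroup H] [InnerProductSpace ℂ H] [CompleteSpace H]
  {V : Fin N → K →L[ℂ] K} {S : Fin N → H →L[ℂ] H} {J : K →ₗᵢ[ℂ] H} {K₀ : Submodule ℂ K}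

theorem IsCuntzDilation.isWalkFamily [Fintype M] (hS : IsCuntzDilation V S J)
    {e : OrthonormalBasis M ℂ K₀} {g : Fin N → M → M} {ν : Fin N → M → ℂ}
    (hwalk : ActsAsRandomWalk V K₀ e g ν) : IsWalkFamily S (fun c => J (e c : K)) g ν where
  cuntz := hS.cuntz
  orthonormal := (e.orthonormal.comp_linearIsometry K₀.subtypeₗᵢ).comp_linearIsometry J
  adjoint_apply i c := by rw [hS.adjoint_apply, hwalk.adjoint_apply, map_smul]
  injective := hwalk.injective

theorem IsCuntzDilation.inner_wordOp (hS : IsCuntzDilation V S J) (ω : List (Fin N)) (k v : K) :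
    ⟪wordOp S ω (J k), J v⟫_ℂ = ⟪wordOp V ω k, v⟫_ℂ := by
  induction ω generalizing v with
  | nil => exact J.inner_map_map k v
  | cons i ω ih =>
    change ⟪S i (wordOp S ω (J k)), J v⟫_ℂ = ⟪V i (wordOp V ω k), v⟫_ℂ
    rw [← ContinuousLinearMap.adjoint_inner_right, hS.adjoint_apply, ih,
      ContinuousLinearMap.adjoint_inner_right]

/-- The isometry `K₀ → W` induced by `J`. -/
noncomputable def restrictIsometry (J : K →ₗᵢ[ℂ] H) {W : Submodule ℂ H}
    (h : ∀ k ∈ K₀, J k ∈ W) : K₀ →ₗᵢ[ℂ] W where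
  toLinearMap := (J.toLinearMap ∘ₗ K₀.subtype).codRestrict W fun k => h k k.2
  norm_map' k := J.norm_map (k : K)

/-- The restriction of a Cuntz dilation to the subspace spanned by an orbit is the Cuntz dilation
of the compression. -/
theorem IsCuntzDilation.restrict [CompleteSpace K₀] (hS : IsCuntzDilation V S J)
    (hK₀ : ∀ i, ∀ x ∈ K₀, ContinuousLinearMap.adjoint (V i) x ∈ K₀) {x₀ : K} (hx₀ : x₀ ∈ K₀)
    (hinv : IsInvariantSubspace S (orbitSpace S (J x₀)))
    (hJ : ∀ k ∈ K₀, J k ∈ orbitSpace S (J x₀)) :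
    IsCuntzDilation (fun i => compress K₀ (V i)) (fun i => restrictOp (S i) (hinv.1 i))
      (restrictIsometry J hJ) where
  cuntz := hS.cuntz.restrictOp hinv
  adjoint_apply i k := by
    refine Subtype.ext ?_
    rw [coe_adjoint_restrictOp (hinv.1 i) (hinv.2 i)]
    change ContinuousLinearMap.adjoint (S i) (J k) =
      J (ContinuousLinearMap.adjoint (compress K₀ (V i)) k : K)
    rw [coe_adjoint_compress_apply (hK₀ i k k.2), hS.adjoint_apply]
  compression i := by
    refine ContinuousLinearMap.ext fun k' => ext_inner_left ℂ fun k => ?_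
    rw [inner_compress, ContinuousLinearMap.comp_apply, ContinuousLinearMap.adjoint_inner_right]
    change _ = ⟪J k, S i (J k')⟫_ℂ
    rw [← ContinuousLinearMap.adjoint_inner_left (S i), hS.adjoint_apply, J.inner_map_map,
      ContinuousLinearMap.adjoint_inner_left]
  cyclic U hU hUinv hUJ := by
    have hclosed : IsClosed ((U.map (orbitSpace S (J x₀)).subtype : Submodule ℂ H) : Set H) := by
      rw [Submodule.map_coe]
      exact (Submodule.isClosed_topologicalClosure _).isClosedEmbedding_subtypeVal.isClosedMap _ hU
    have hword : ∀ ω, wordOp S ω (J x₀) ∈ U.map (orbitSpace S (J x₀)).subtype := by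
      intro ω
      induction ω with
      | nil => exact ⟨_, hUJ ⟨x₀, hx₀⟩, rfl⟩
      | cons i ω ih =>
        obtain ⟨y, hy, hyω⟩ := ih
        exact ⟨_, hUinv.1 i y hy, congrArg (S i) hyω⟩
    have hle : orbitSpace S (J x₀) ≤ U.map (orbitSpace S (J x₀)).subtype :=
      closedSpan_le hclosed (by rintro _ ⟨ω, rfl⟩; exact hword ω)
    rw [Submodule.eq_top_iff']
    intro y
    obtain ⟨z, hz, hzy⟩ := hle y.2
    rwa [← Subtype.ext hzy]

omit [CompleteSpace K] [CompleteSpace H] in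
theorem forall_mem_of_orthonormalBasis [Fintype M] (e : OrthonormalBasis M ℂ K₀)
    {W : Submodule ℂ H} (h : ∀ c, J (e c : K) ∈ W) : ∀ k ∈ K₀, J k ∈ W := by
  intro k hk
  have h1 := congrArg (fun x : K₀ => J (x : K)) (e.sum_repr ⟨k, hk⟩)
  simp only [Submodule.coe_sum, Submodule.coe_smul, map_sum, map_smul] at h1
  rw [← h1]
  exact Submodule.sum_mem _ fun c _ => Submodule.smul_mem _ _ (h c)

variable [Fintype M] {e : OrthonormalBasis M ℂ K₀} {g : Fin N → M → M} {ν : Fin N → M → ℂ}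

/-- For a reversing walk, the vectors of `K` have the same projections on all the spaces
`cycleSpace S g ν c (J (e c)) n` and on the orbit space. -/
theorem IsReversing.sub_starProjection_mem_orthogonal (hS : IsCuntzDilation V S J)
    (hwalk : ActsAsRandomWalk V K₀ e g ν) (hrev : IsReversing V e g ν) (c : M) (v : K) :
    J v - (cycleSpace S g ν c (J (e c : K)) 0).starProjection (J v) ∈
      (orbitSpace S (J (e c : K)))ᗮ := by
  refine (hS.isWalkFamily hwalk).sub_starProjection_mem_orthogonal fun ω γ hγ => ?_
  have h1 := hrev.wordOp_apply hγ.2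
  rw [hγ.1] at h1
  rw [hS.inner_wordOp, hS.inner_wordOp, wordOp_append, h1, map_smul, inner_smul_left,
    Complex.conj_conj]

theorem IsReversing.starProjection_eq (hS : IsCuntzDilation V S J)
    (hwalk : ActsAsRandomWalk V K₀ e g ν) (hrev : IsReversing V e g ν) (c : M) (v : K)
    {W : Submodule ℂ H} [W.HasOrthogonalProjection]
    (h0 : cycleSpace S g ν c (J (e c : K)) 0 ≤ W) (hW : W ≤ orbitSpace S (J (e c : K))) :
    W.starProjection (J v) =
      (cycleSpace S g ν c (J (e c : K)) 0).starProjection (J v) :=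
  Submodule.eq_starProjection_of_mem_orthogonal (h0 (Submodule.starProjection_apply_mem _ _))
    (Submodule.orthogonal_le hW (hrev.sub_starProjection_mem_orthogonal hS hwalk c v))

/-- Parseval's identity in the orthonormal basis for `n = 0`; the coefficients can be computed in
`K` by `inner_wordOp`. -/
theorem IsCuntzDilation.hasSum_norm_sq_inner (hS : IsCuntzDilation V S J)
    (hwalk : ActsAsRandomWalk V K₀ e g ν) (c : M) (v : K) :
    HasSum (fun ω : acyclicWords g ν c => ‖⟪wordOp V ω (e c : K), v⟫_ℂ‖ ^ 2)
      (‖(cycleSpace S g ν c (J (e c : K)) 0).orthogonalProjectionOnto (J v)‖ ^ 2) := by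
  set W := cycleSpace S g ν c (J (e c : K)) 0 with hW
  obtain ⟨b, hb⟩ : ∃ b : HilbertBasis (cycleWords g ν c 0) ℂ W,
      ∀ ω, (b ω : H) = wordOp S (ω : List (Fin N)) (J (e c : K)) :=
    (hS.isWalkFamily hwalk).exists_hilbertBasis c 0
  have h1 := b.hasSum_inner_mul_inner (W.orthogonalProjectionOnto (J v))
    (W.orthogonalProjectionOnto (J v))
  have h2 : ∀ ω, ⟪b ω, W.orthogonalProjectionOnto (J v)⟫_ℂ = ⟪wordOp V ω (e c : K), v⟫_ℂ := by
    intro ω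
    rw [Submodule.inner_orthogonalProjectionOnto_eq_of_mem_left, hb, hS.inner_wordOp]
  have h3 : HasSum (fun ω : cycleWords g ν c 0 => ‖⟪wordOp V ω (e c : K), v⟫_ℂ‖ ^ 2)
      (‖W.orthogonalProjectionOnto (J v)‖ ^ 2) := by
    have h0 : ⟪W.orthogonalProjectionOnto (J v), W.orthogonalProjectionOnto (J v)⟫_ℂ =
        ((‖W.orthogonalProjectionOnto (J v)‖ ^ 2 : ℝ) : ℂ) := by
      rw [inner_self_eq_norm_sq_to_K]
      norm_cast
    rw [h0] at h1
    have h4 : ∀ ω, ⟪W.orthogonalProjectionOnto (J v), b ω⟫_ℂ *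
        ⟪b ω, W.orthogonalProjectionOnto (J v)⟫_ℂ =
          ((‖⟪wordOp V ω (e c : K), v⟫_ℂ‖ ^ 2 : ℝ) : ℂ) := by
      intro ω
      rw [← inner_conj_symm, h2, RCLike.conj_mul]
      norm_cast
    simp only [h4] at h1
    exact Complex.hasSum_ofReal.1 h1
  rwa [cycleWords_zero] at h3

/-- For a reversing walk, the family `V_ω e_c` is a Parseval frame exactly when the orbit space is
the whole space. -/
theorem IsReversing.isParsevalFrame_iff (hS : IsCuntzDilation V S J)
    (hwalk : ActsAsRandomWalk V K₀ e g ν) (hrev : IsReversing V e g ν) (c : M)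
    (hinv : IsInvariantSubspace S (orbitSpace S (J (e c : K)))) :
    IsParsevalFrame (fun ω : acyclicWords g ν c => wordOp V ω (e c : K)) ↔
      orbitSpace S (J (e c : K)) = ⊤ := by
  set W := orbitSpace S (J (e c : K)) with hW
  have hsum : ∀ v : K, HasSum (fun ω : acyclicWords g ν c => ‖⟪v, wordOp V ω (e c : K)⟫_ℂ‖ ^ 2)
      (‖W.starProjection (J v)‖ ^ 2) := by
    intro v
    have h1 := hS.hasSum_norm_sq_inner hwalk c v
    rw [hrev.starProjection_eq hS hwalk c v (cycleSpace_le_orbitSpace S g ν c _ 0) le_rfl]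
    simp only [norm_inner_symm v]
    exact h1
  constructor
  · intro hframe
    -- The frame identity says that projecting `J v` onto `W` preserves its norm, so `J v ∈ W`;
    -- cyclicity of `K` then gives all of `H`.
    refine hS.cyclic W (Submodule.isClosed_topologicalClosure _) hinv fun v => ?_
    have h1 : ‖W.starProjection (J v)‖ ^ 2 = ‖v‖ ^ 2 := (hsum v).unique (hframe v)
    have h2 := W.norm_sq_eq_add_norm_sq_starProjection (J v)
    rw [h1, J.norm_map, left_eq_add, sq_eq_zero_iff, norm_eq_zero,
      Submodule.starProjection_orthogonal_val, sub_eq_zero] at h2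
    exact Submodule.starProjection_eq_self_iff.1 h2.symm
  · intro htop v
    have h1 := hsum v
    rwa [Submodule.starProjection_eq_self_iff.2 (by rw [htop]; trivial), J.norm_map] at h1

theorem IsCuntzDilation.exists_eq_smul_id [CompleteSpace K₀] (hV : IsRowCoisometry V)
    (hS : IsCuntzDilation V S J) (hwalk : ActsAsRandomWalk V K₀ e g ν)
    (hsimple : IsSimpleOn V K₀) (c : M) (htop : orbitSpace S (J (e c : K)) = ⊤)
    {T : K →L[ℂ] K} (hT : conjSum V T = T) : ∃ z : ℂ, T = z • ContinuousLinearMap.id ℂ K := by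
  obtain ⟨z, hz⟩ := hsimple.exists_eq_smul_id (conjSum_compress hwalk.invariant hT)
  -- `T - z` is again a fixed point, because `V` is a row co-isometry, and its compression to `K₀`
  -- is zero.
  refine ⟨z, sub_eq_zero.1 ?_⟩
  refine hS.eq_zero_of_conjSum_eq hwalk.invariant (e c).2 htop ?_ fun k hk k' hk' => ?_
  · rw [conjSum_sub, hT, conjSum_smul_id hV]
  · have h1 := inner_compress K₀ T ⟨k, hk⟩ ⟨k', hk'⟩
    rw [hz] at h1
    simp only [smul_apply, ContinuousLinearMap.id_apply, inner_smul_right,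
      Submodule.coe_inner] at h1
    simp [← h1]

end DilationWalk

end CuntzWalk


/-! ### The main theorem -/

theorem theorem2p5 {N : ℕ} (hN : 2 ≤ N)
    {K : Type*} [NormedAddCommGroup K] [InnerProductSpace ℂ K] [CompleteSpace K]
    {H : Type*} [NormedAddCommGroup H] [InnerProductSpace ℂ H] [CompleteSpace H]
    (V : Fin N → K →L[ℂ] K) (hV : IsRowCoisometry V)
    (S : Fin N → H →L[ℂ] H) (J : K →ₗᵢ[ℂ] H) (hS : IsCuntzDilation V S J)
    (K₀ : Submodule ℂ K) [CompleteSpace K₀]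
    {M : Type*} [Fintype M] (e : OrthonormalBasis M ℂ K₀)
    (g : Fin N → M → M) (ν : Fin N → M → ℂ)
    (hwalk : ActsAsRandomWalk V K₀ e g ν) (hirr : IsIrreducibleWalk g ν)
    (hsimple : IsSimpleOn V K₀) (c : M) :
    -- (a)
    (∀ n, ∃ b : HilbertBasis (cycleWords g ν c n) ℂ (cycleSpace S g ν c (J (e c)) n),
      ∀ ω, (b ω : H) = wordOp S ω (J (e c))) ∧
    -- (b)
    (∀ n, cycleSpace S g ν c (J (e c)) n ≤ cycleSpace S g ν c (J (e c)) (n + 1)) ∧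
    -- (c)
    ((⋃ n, cycleVectors S g ν c (J (e c)) n) = Set.range fun ω => wordOp S ω (J (e c))) ∧
    -- (d)
    ((orbitSpace S (J (e c)) : Set H) =
        closure (⋃ n, (cycleSpace S g ν c (J (e c)) n : Set H)) ∧
      IsInvariantSubspace S (orbitSpace S (J (e c))) ∧
      IsRowCoisometry (fun i => compress K₀ (V i)) ∧
      ∃ (S' : Fin N → orbitSpace S (J (e c)) →L[ℂ] orbitSpace S (J (e c)))
        (J' : K₀ →ₗᵢ[ℂ] orbitSpace S (J (e c))),
        (∀ i x, (S' i x : H) = S i x) ∧ (∀ x, (J' x : H) = J x) ∧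
        IsCuntzDilation (fun i => compress K₀ (V i)) S' J' ∧ IsIrreducibleRep S') ∧
    -- the equivalences (i)-(iii)
    [orbitSpace S (J (e c)) = ⊤,
      IsIrreducibleRep S,
      ∀ T : K →L[ℂ] K, ∑ i, V i ∘L T ∘L ContinuousLinearMap.adjoint (V i) = T →
        ∃ z : ℂ, T = z • ContinuousLinearMap.id ℂ K].TFAE ∧
    -- (e), and the equivalence with (iv)
    (IsReversing V e g ν →
      (∀ n, ∀ v : K,
        HasSum (fun ω : acyclicWords g ν c => ‖⟪wordOp V ω (e c), v⟫_ℂ‖ ^ 2)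
          (‖(cycleSpace S g ν c (J (e c)) n).orthogonalProjectionOnto (J v)‖ ^ 2) ∧
        ‖(cycleSpace S g ν c (J (e c)) n).orthogonalProjectionOnto (J v)‖ ^ 2 =
          ‖(cycleSpace S g ν c (J (e c)) 0).orthogonalProjectionOnto (J v)‖ ^ 2 ∧
        ‖(cycleSpace S g ν c (J (e c)) 0).orthogonalProjectionOnto (J v)‖ ^ 2 =
          ‖(orbitSpace S (J (e c))).orthogonalProjectionOnto (J v)‖ ^ 2) ∧
      [orbitSpace S (J (e c)) = ⊤,
        IsIrreducibleRep S,
        ∀ T : K →L[ℂ] K, ∑ i, V i ∘L T ∘L ContinuousLinearMap.adjoint (V i) = T →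
          ∃ z : ℂ, T = z • ContinuousLinearMap.id ℂ K,
        IsParsevalFrame fun ω : acyclicWords g ν c => wordOp V ω (e c : K)].TFAE) := by
  have hf : IsWalkFamily S (fun c => J (e c : K)) g ν := hS.isWalkFamily hwalk
  have hinv : IsInvariantSubspace S (orbitSpace S (J (e c : K))) :=
    hf.isInvariantSubspace_orbitSpace hirr c
  have hJ : ∀ k ∈ K₀, J k ∈ orbitSpace S (J (e c : K)) :=
    forall_mem_of_orthonormalBasis e (hf.mem_orbitSpace hirr c)
  have hne : J (e c : K) ≠ 0 := hf.orthonormal.ne_zero c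
  have hdil := hS.restrict hwalk.invariant (e c).2 hinv hJ
  have : Nontrivial (orbitSpace S (J (e c : K))) :=
    ⟨⟨⟨_, hJ _ (e c).2⟩, 0, fun h => hne (congrArg Subtype.val h)⟩⟩
  have : Nontrivial H := ⟨⟨_, 0, hne⟩⟩
  -- Simplicity on `K₀` is precisely the scalar fixed point condition for the compressed row
  -- co-isometry.
  have hirrep := hdil.isIrreducibleRep fun T hT => hsimple.exists_eq_smul_id hT
  have h12 : orbitSpace S (J (e c : K)) = ⊤ → IsIrreducibleRep S := fun htop =>
    hirrep.of_restrictOp_top htop fun _ _ => rfl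
  have h21 : IsIrreducibleRep S → orbitSpace S (J (e c : K)) = ⊤ := fun h =>
    (h.2 _ (Submodule.isClosed_topologicalClosure _) hinv).resolve_left fun h0 =>
      hne ((Submodule.eq_bot_iff _).1 h0 _ (hJ _ (e c).2))
  have h13 : orbitSpace S (J (e c : K)) = ⊤ → ∀ T : K →L[ℂ] K,
      ∑ i, V i ∘L T ∘L ContinuousLinearMap.adjoint (V i) = T →
        ∃ z : ℂ, T = z • ContinuousLinearMap.id ℂ K := fun htop _ hT =>
    hS.exists_eq_smul_id hV hwalk hsimple c htop hT
  have h32 : (∀ T : K →L[ℂ] K, ∑ i, V i ∘L T ∘L ContinuousLinearMap.adjoint (V i) = T →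
      ∃ z : ℂ, T = z • ContinuousLinearMap.id ℂ K) → IsIrreducibleRep S := fun h =>
    hS.isIrreducibleRep h
  refine ⟨hf.exists_hilbertBasis c, hf.cycleSpace_le_succ hirr c,
    iUnion_cycleVectors S g ν c _, ⟨hf.coe_orbitSpace hirr c, hinv,
      isRowCoisometry_compress hV hwalk.invariant, _, _, fun _ _ => rfl, fun _ => rfl, hdil,
      hirrep⟩, ?_, fun hrev => ⟨fun n v => ?_, ?_⟩⟩
  · tfae_have 1 → 2 := h12
    tfae_have 2 → 1 := h21
    tfae_have 1 → 3 := h13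
    tfae_have 3 → 2 := h32
    tfae_finish
  · have hproj : ∀ m, ‖(cycleSpace S g ν c (J (e c : K)) m).orthogonalProjectionOnto (J v)‖ =
        ‖(cycleSpace S g ν c (J (e c : K)) 0).orthogonalProjectionOnto (J v)‖ := fun m =>
      congrArg norm (hrev.starProjection_eq hS hwalk c v
        (monotone_nat_of_le_succ (hf.cycleSpace_le_succ hirr c) (Nat.zero_le m))
        (cycleSpace_le_orbitSpace S g ν c _ m))
    refine ⟨?_, by rw [hproj n], ?_⟩
    · rw [hproj n]
      exact hS.hasSum_norm_sq_inner hwalk c v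
    · exact congrArg (fun x => ‖x‖ ^ 2) (hrev.starProjection_eq hS hwalk c v
        (cycleSpace_le_orbitSpace S g ν c _ 0) le_rfl).symm
  · have h41 := hrev.isParsevalFrame_iff hS hwalk c hinv
    tfae_have 1 → 2 := h12
    tfae_have 2 → 1 := h21
    tfae_have 1 → 3 := h13
    tfae_have 3 → 2 := h32
    tfae_have 4 ↔ 1 := h41
    tfae_finish
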